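/- \textbf{Setting.} Let the clockwork be $\mathcal H_C=\mathbb C^d$, $d\ge 1$, and the register $\mathcal H_T=\mathbb C^{N_T+1}$, $N_T\ge 1$, with orthonormal basis $|0\rangle,\dots,|N_T\rangle$, where $k+1$, $k+l$ are taken modulo $N_T+1$. $\mathcal S(\cdot)$ denotes density operators. A family of channels is $(\mathcal M^t)_{t\ge 0}$ with each $\mathcal M^t$ a completely positive trace-preserving linear map on operators on $\mathcal H_C\otimes\mathcal H_T$; put $\mathcal M^{t,k}(\rho)=\mathcal M^t(\rho\otimes|k\rangle\langle k|)$ and $p^{(k)}_l(t)=\mathrm{tr}[\mathcal M^{t,k}(\rho)|l\rangle\langle l|]$. Consider the conditions (for all $t,t_1,t_2\ge0$, $\rho\in\mathcal S(\mathcal H_C)$ and all register indices $k,k',l$): 1) $\mathrm{tr}_T[\mathcal M^{t,k}(\rho)|k+l\rangle\langle k+l|]=\mathrm{tr}_T[\mathcal M^{t,k'}(\rho)|k'+l\rangle\langle k'+l|]$; 2) $\mathcal M^{t_1+t_2}=\mathcal M^{t_2}\circ\mathcal M^{t_1}$; 3) $\mathcal M^0=\mathrm{id}$ and $\lim_{t\to0^+}\|\mathcal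 M^t-\mathrm{id}\|=0$; 4) $\sum_{l\notin\{k,k+1\}}p^{(k)}_l(t)=o\big(p^{(k)}_{k+1}(t)\big)$ as $t\to0^+$; 5) there is a family of channels $\tilde{\mathcal M}$ satisfying 1)--4) such that, as $t\to0^+$, $\mathcal M^{t,k}(\rho)=\tilde{\mathcal M}^{t,k}(\rho)+o(t)$ for $k<N_T$ and $\mathrm{tr}_C[\mathcal M^{t,N_T}(\rho)]=|N_T\rangle\langle N_T|+o(t)$. A \emph{ticking clock} is a pair $(\rho^0,(\mathcal M^t)_{t\ge0})$ with $\rho^0\in\mathcal S(\mathcal H_C\otimes\mathcal H_T)$ and a family of channels satisfying 1)--4) (periodic register), respectively 2) and 5) (cut-off register). It has a \emph{classical register} if for all $t\ge 0$, $k$ and $\rho\in\mathcal S(\mathcal H_C)$, $\mathcal M^{t,k}(\rho)=\sum_n\rho^{(n;k)}(t)\otimes|n\rangle\langle n|$ with subnormalised states $\rho^{(n;k)}(t)$. Two ticking clocks with a cut-off register are \emph{clockwork equivalent} if 5) holds for both with the same $\tilde{\mathcal M}$ and their clockwork states $\mathrm{tr}_T[\mathcal M^{t,N_T}(\rho)]$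 differ for some $t\ge0$ and $\rho$. Let $\theta(k)=1$ for a periodic register and $\theta(k)=1-\delta_{k,N_T}$ for a cut-off register. A family of channels $\mathcal M$ is \emph{implicitly represented} by a Hermitian operator $H$ and finite sequences $(L_j)_{j=1}^m,(J_j)_{j=1}^m$ of operators on $\mathcal H_C$ (all independent of $t$ and $k$) if for all $t\ge0$, all $k$ and all $\rho\in\mathcal S(\mathcal H_C)$ $$\mathcal M^{t,k}(\rho)=\lim_{N\to\infty}\big(\mathcal M^{t/N}\big)^{\circ(N-1)}\circ\mathcal M^{t/N,k}(\rho),$$ where, for $\delta\ge0$, $$\mathcal M^{\delta,k}(\rho)=\rho\otimes|k\rangle\langle k|+\delta\,\mathcal C_{(1,k)}(\rho)\otimes|k\rangle\langle k|+\delta\,\mathcal C_{(2,k)}(\rho)\otimes|k+1\rangle\langle k+1|+F^{\delta,k}(\rho),$$ with $F^{0,k}(\rho)=0$, $F^{\delta,k}(\rho)=o(\delta)$ entrywise as $\delta\to0^+$, and $$\mathcal C_{(1,k)}(X)=-i[H,X]-\tfrac12\sum_j\{L_j^\dagger L_j+\theta(k)J_j^\dagger J_j,X\}+\sum_jL_jXL_j^\dagger,\qquad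 \mathcal C_{(2,k)}(X)=\theta(k)\sum_jJ_jXJ_j^\dagger .$$ \textbf{Lemma (Implicit ticking clock representation).} For either kind of register and every $\rho^0\in\mathcal S(\mathcal H_C\otimes\mathcal H_T)$: (Necessity) If $(\rho^0,\mathcal M)$ is a ticking clock with a classical register, then there is a ticking clock $(\rho^0,\mathcal M')$ with a classical register which is equal to it or, in the cut-off case only, clockwork equivalent to it, such that $\mathcal M'$ is implicitly represented by some $H,(L_j),(J_j)$. (Sufficiency) For all Hermitian $H$ and all finite sequences $(L_j)_{j=1}^m,(J_j)_{j=1}^m$ of operators on $\mathcal H_C$ there is a ticking clock $(\rho^0,\mathcal M')$ with a classical register that is implicitly represented by them, and every family of channels $\mathcal M$ implicitly represented by them satisfies $\mathcal M^{t,k}(\rho)=\mathcal M'^{t,k}(\rho)$ for all $t\ge0$, $k$ and $\rho\in\mathcal S(\mathcal H_C)$. -/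

import Mathlib

open Filter Topology Asymptotics
open scoped Matrix Kronecker ComplexOrder Matrix.Norms.Elementwise

namespace TickingClock

noncomputable section

/-! ### States and channels on finite-dimensional systems

The clockwork is `ℂ^d` with basis indexed by `Fin d`, the tick register is `ℂ^(NT+1)` with its
distinguished orthonormal basis `|0⟩, …, |NT⟩` indexed by `Fin (NT + 1)`.  Addition in
`Fin (NT + 1)` is addition modulo `NT + 1`. -/

/-- Operators on the clockwork. -/
abbrev ClockworkOp (d : ℕ) := Matrix (Fin d) (Fin d) ℂ

/-- Operators on clockwork and register. -/
abbrev JointOp (d NT : ℕ) := Matrix (Fin d × Fin (NT + 1)) (Fin d × Fin (NT + 1)) ℂ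

/-- Linear maps from joint operators to joint operators; the monoid power is iterated
composition. -/
abbrev JointMap (d NT : ℕ) := Module.End ℂ (JointOp d NT)

/-- Density operators. -/
def IsState {ι : Type*} [Fintype ι] (ρ : Matrix ι ι ℂ) : Prop :=
  ρ.PosSemidef ∧ ρ.trace = 1

/-- The ampliation `Φ ⊗ id_n`, acting on operators of the system tensored with an ancilla
`ℂ^n`. -/
def ampliation {ι : Type*} (n : ℕ) (Φ : Module.End ℂ (Matrix ι ι ℂ))
    (X : Matrix (ι × Fin n) (ι × Fin n) ℂ) : Matrix (ι × Fin n) (ι × Fin n) ℂ :=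
  fun p q => Φ (fun i j => X (i, p.2) (j, q.2)) p.1 q.1

/-- Quantum channels: completely positive and trace preserving linear maps. -/
def IsQuantumChannel {ι : Type*} [Fintype ι] (Φ : Module.End ℂ (Matrix ι ι ℂ)) : Prop :=
  (∀ (n : ℕ) (X : Matrix (ι × Fin n) (ι × Fin n) ℂ),
      X.PosSemidef → (ampliation n Φ X).PosSemidef) ∧
    ∀ X : Matrix ι ι ℂ, (Φ X).trace = X.trace

variable {d NT : ℕ}

/-- Partial trace over the register. -/
def traceRegister (X : JointOp d NT) : ClockworkOp d :=
  fun i j => ∑ n, X (i, n) (j, n)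

/-- Partial trace over the clockwork. -/
def traceClockwork (X : JointOp d NT) : Matrix (Fin (NT + 1)) (Fin (NT + 1)) ℂ :=
  fun m n => ∑ i, X (i, m) (i, n)

/-- The register projector `|l⟩⟨l|`. -/
def regProj (l : Fin (NT + 1)) : Matrix (Fin (NT + 1)) (Fin (NT + 1)) ℂ :=
  Matrix.single l l 1

/-- The operator `A ⊗ |k⟩⟨k|`. -/
def withReg (A : ClockworkOp d) (k : Fin (NT + 1)) : JointOp d NT :=
  A ⊗ₖ regProj k

/-- A one-parameter family of channels, indexed by times `t ≥ 0` (values at negative `t` play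
no role). -/
def IsChannelFamily (M : ℝ → JointMap d NT) : Prop :=
  ∀ t, 0 ≤ t → IsQuantumChannel (M t)

/-- The channel `ρ ↦ M^t (ρ ⊗ |k⟩⟨k|)` from the clockwork to clockwork and register. -/
def chanFrom (M : ℝ → JointMap d NT) (t : ℝ) (k : Fin (NT + 1)) (ρ : ClockworkOp d) :
    JointOp d NT :=
  M t (withReg ρ k)

/-- Unnormalised clockwork state given that the register is found in `|l⟩`:
`tr_register [X |l⟩⟨l|]`. -/
def clockworkGiven (X : JointOp d NT) (l : Fin (NT + 1)) : ClockworkOp d :=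
  traceRegister (X * withReg 1 l)

/-- Probability of finding the register in `|l⟩` at time `t`, when it started in `|k⟩` and the
clockwork started in `ρ`. -/
def tickProb (M : ℝ → JointMap d NT) (ρ : ClockworkOp d) (k l : Fin (NT + 1)) (t : ℝ) : ℝ :=
  (chanFrom M t k ρ * withReg 1 l).trace.re

/-! ### The ticking clock conditions -/

/-- Condition 1, time invariance: translating the input and the output state of the periodic
register by the same amount (modulo `NT + 1`) does not change the clockwork. -/
def TimeInvariant (M : ℝ → JointMap d NT) : Prop :=
  ∀ t, 0 ≤ t → ∀ ρ : ClockworkOp d, IsState ρ → ∀ k k' l : Fin (NT + 1),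
    clockworkGiven (chanFrom M t k ρ) (k + l) = clockworkGiven (chanFrom M t k' ρ) (k' + l)

/-- Condition 2, self-timing. -/
def SelfTiming (M : ℝ → JointMap d NT) : Prop :=
  ∀ t₁ t₂, 0 ≤ t₁ → 0 ≤ t₂ → M (t₁ + t₂) = M t₂ * M t₁

/-- Condition 3, zeroth order: the channel is the identity at time zero, and converges to it in
operator norm as `t → 0⁺` (all norms on this finite-dimensional space are equivalent; the one
used here is induced by the maximal modulus of matrix entries). -/
def ZerothOrder (M : ℝ → JointMap d NT) : Prop :=
  M 0 = 1 ∧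
    ∀ ε : ℝ, 0 < ε → ∀ᶠ t in 𝓝[>] (0 : ℝ), ∀ X : JointOp d NT, ‖M t X - X‖ ≤ ε * ‖X‖

/-- Condition 4, leading order: the probability of finding the register neither in `k` nor in its
successor is negligible against the probability of finding it in the successor.  Little-o is the
limit condition on the quotient, without dividing by a probability that may vanish. -/
def LeadingOrder (M : ℝ → JointMap d NT) : Prop :=
  ∀ ρ : ClockworkOp d, IsState ρ → ∀ k : Fin (NT + 1),
    (fun t => ∑ l with l ≠ k ∧ l ≠ k + 1, tickProb M ρ k l t)
      =o[𝓝[>] 0] (fun t => tickProb M ρ k (k + 1) t)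

/-- Ticking clock channels with a periodic register: conditions 1 to 4. -/
def IsPeriodicChannel (M : ℝ → JointMap d NT) : Prop :=
  IsChannelFamily M ∧ TimeInvariant M ∧ SelfTiming M ∧ ZerothOrder M ∧ LeadingOrder M

/-- The relation in condition 5 between a channel `M` with cut-off register and an underlying
channel `P` with periodic register. -/
def CutoffOf (M P : ℝ → JointMap d NT) : Prop :=
  (∀ k : Fin (NT + 1), k ≠ Fin.last NT → ∀ ρ : ClockworkOp d, IsState ρ →
      (fun t => chanFrom M t k ρ - chanFrom P t k ρ) =o[𝓝[>] 0] (fun t : ℝ => t)) ∧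
    ∀ ρ : ClockworkOp d, IsState ρ →
      (fun t => traceClockwork (chanFrom M t (Fin.last NT) ρ) - regProj (Fin.last NT))
        =o[𝓝[>] 0] (fun t : ℝ => t)

/-- The two kinds of register. -/
inductive RegisterKind
  | periodic
  | cutoff

/-- Ticking clocks `(ρ₀, M)`: an initial state and a family of channels satisfying conditions
1 to 4 for a periodic register, conditions 2 and 5 for a cut-off register. -/
def IsTickingClock (r : RegisterKind) (ρ₀ : JointOp d NT) (M : ℝ → JointMap d NT) : Prop :=
  IsState ρ₀ ∧
    match r with
    | .periodic => IsPeriodicChannel M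
    | .cutoff => IsChannelFamily M ∧ SelfTiming M ∧
        ∃ P : ℝ → JointMap d NT, IsPeriodicChannel P ∧ CutoffOf M P

/-- Classical register: register basis states are mapped to operators that are block diagonal in
the register basis, the blocks being subnormalised clockwork states. -/
def HasClassicalRegister (M : ℝ → JointMap d NT) : Prop :=
  ∀ t, 0 ≤ t → ∀ (k : Fin (NT + 1)) (ρ : ClockworkOp d), IsState ρ →
    ∃ σ : Fin (NT + 1) → ClockworkOp d,
      (∀ n, (σ n).PosSemidef ∧ (σ n).trace.re ≤ 1) ∧
        chanFrom M t k ρ = ∑ n, withReg (σ n) n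

/-- Clockwork equivalence of two ticking clocks with a cut-off register: they have the same
underlying channel with periodic register, and the clockwork states obtained from the final
register state differ. -/
def ClockworkEquivalent (ρ₀ ρ₁ : JointOp d NT) (M₀ M₁ : ℝ → JointMap d NT) : Prop :=
  IsTickingClock .cutoff ρ₀ M₀ ∧ IsTickingClock .cutoff ρ₁ M₁ ∧
    (∃ P : ℝ → JointMap d NT, IsPeriodicChannel P ∧ CutoffOf M₀ P ∧ CutoffOf M₁ P) ∧
    ∃ t, 0 ≤ t ∧ ∃ ρ : ClockworkOp d, IsState ρ ∧
      traceRegister (chanFrom M₀ t (Fin.last NT) ρ) ≠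
        traceRegister (chanFrom M₁ t (Fin.last NT) ρ)

/-! ### The generator representation -/

/-- `θ(k)`: equal to one, except that it vanishes at `k = NT` for a cut-off register. -/
def theta (r : RegisterKind) (k : Fin (NT + 1)) : ℂ :=
  match r with
  | .periodic => 1
  | .cutoff => if k = Fin.last NT then 0 else 1

/-- The no-tick generator
`-i[H, X] - ½ ∑ⱼ {Lⱼ†Lⱼ + θ(k) Jⱼ†Jⱼ, X} + ∑ⱼ Lⱼ X Lⱼ†`. -/
def noTickGen (r : RegisterKind) {m : ℕ} (H : ClockworkOp d) (L J : Fin m → ClockworkOp d)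
    (k : Fin (NT + 1)) (X : ClockworkOp d) : ClockworkOp d :=
  -(Complex.I • (H * X - X * H))
    - (1 / 2 : ℂ) • ∑ j, (((L j)ᴴ * L j + theta r k • ((J j)ᴴ * J j)) * X
        + X * ((L j)ᴴ * L j + theta r k • ((J j)ᴴ * J j)))
    + ∑ j, L j * X * (L j)ᴴ

/-- The tick generator `θ(k) ∑ⱼ Jⱼ X Jⱼ†`. -/
def tickGen (r : RegisterKind) {m : ℕ} (J : Fin m → ClockworkOp d)
    (k : Fin (NT + 1)) (X : ClockworkOp d) : ClockworkOp d :=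
  theta r k • ∑ j, J j * X * (J j)ᴴ

/-- The short-time map without its remainder:
`ρ ⊗ |k⟩⟨k| + δ C₁ₖ(ρ) ⊗ |k⟩⟨k| + δ C₂ₖ(ρ) ⊗ |k+1⟩⟨k+1|`. -/
def shortTimeMap (r : RegisterKind) {m : ℕ} (H : ClockworkOp d) (L J : Fin m → ClockworkOp d)
    (δ : ℝ) (k : Fin (NT + 1)) (ρ : ClockworkOp d) : JointOp d NT :=
  withReg ρ k + (δ : ℂ) • withReg (noTickGen r H L J k ρ) k
    + (δ : ℂ) • withReg (tickGen r J k ρ) (k + 1)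

/-- The implicit representation by `H`, `(Lⱼ)`, `(Jⱼ)`: the channel is the limit of `N`-fold
compositions of the channel for time `t / N`, which is given by the short-time map up to a
remainder `F` that is `o(δ)` entrywise for small `δ ≥ 0` (the norm of a matrix is here the maximal
modulus of its entries; `o(δ)` at `δ = 0` means that `F` vanishes there). -/
def HasImplicitRepresentation (r : RegisterKind) (M : ℝ → JointMap d NT) {m : ℕ}
    (H : ClockworkOp d) (L J : Fin m → ClockworkOp d) : Prop :=
  (∀ t, 0 ≤ t → ∀ (k : Fin (NT + 1)) (ρ : ClockworkOp d), IsState ρ →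
      Tendsto (fun N : ℕ => (M (t / N) ^ (N - 1)) (chanFrom M (t / N) k ρ)) atTop
        (𝓝 (chanFrom M t k ρ))) ∧
    ∀ (k : Fin (NT + 1)) (ρ : ClockworkOp d), IsState ρ →
      (fun δ => chanFrom M δ k ρ - shortTimeMap r H L J δ k ρ) =o[𝓝[≥] 0] (fun δ : ℝ => δ)

/-- Equality of the channels `M^{t,k}` for all times and all register basis states. -/
def SameFromRegister (M₀ M₁ : ℝ → JointMap d NT) : Prop :=
  ∀ t, 0 ≤ t → ∀ (k : Fin (NT + 1)) (ρ : ClockworkOp d), IsState ρ →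
    chanFrom M₀ t k ρ = chanFrom M₁ t k ρ

end

end TickingClock

open TickingClock

/-! Both directions reduce to the joint generator `G` of the clock and its restriction to operators
that are block diagonal in the register basis.

*Sufficiency.* Put `K = ∑ₖ (-i H - ½ ∑ (L†L + θ(k) J†J)) ⊗ |k⟩⟨k|` and let the Kraus operators
be `Lⱼ ⊗ 1` and `θ(k) Jⱼ ⊗ |k+1⟩⟨k|`.  The map `G X = K X + X K† + ∑ V X V†` (`jointGen`)
annihilates the trace, and `exp (t G)` is the limit of the iterates of
`X ↦ (1 + δ K) X (1 + δ K)† + δ ∑ V X V†`, hence a channel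
(`isQuantumChannel_expFlow_lindbladMap`).  `G` preserves block-diagonal operators and acts there by
`blockGen`, which commutes with cyclic relabelling of the register; this gives the classical
register and time invariance.  For the leading-order condition, let `f` be the probability of the
successor state and `q` that of all states other than the initial one and its successor.  Then
`q' ≤ c f` and `f' ≥ -c f`, so `q = O(t f)` (`clockFlow_leadingOrder`).  For uniqueness, a family
of channels represented by `H`, `L`, `J` agrees with `exp (δ G)` up to `o(δ)` on block-diagonal
operators; off the diagonal nothing is known about it, but channels have uniformly bounded powers,
so a telescoping sum still gives convergence (`tendsto_pow_expFlow`).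

*Necessity.* A continuous semigroup of channels has a generator
(`exists_generator_of_linear_semigroup`).  For a periodic clock, time invariance identifies the
blocks of the generator for different register states and the leading-order condition leaves only
the blocks "no tick" and "one tick".  The latter is completely positive, which yields `J`
(`exists_kraus`); the former is the derivative at the identity of a completely positive family,
which by Lindblad's theorem (`exists_lindblad_form`) yields `K` and `L`; trace preservation fixes
`K + K†`, and the anti-Hermitian part of `K` is `-i H`.  For a cut-off register these operators are
extracted from the underlying periodic clock.  In the final register state nothing is prescribed
for the clockwork, so either the clock is clockwork equivalent to `exp (t G)`, or its clockwork
evolves there in the same way; since the register leaves the final state only with probability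
`o(t)`, in the second case the clock itself has the required short-time expansion
(`exists_implicit_cutoff`). -/

namespace TickingClock

/-! ### Norm-continuous semigroups -/

section Semigroup

/-- A bounded semigroup that is norm continuous at zero has a generator.  Averaging gives the
invertible element `V = ∫₀ᵃ q`, and `q h * V = ∫ₕ^{a+h} q` is differentiable in `h`. -/
theorem exists_generator_of_semigroup {𝔸 : Type*} [NormedRing 𝔸] [NormedAlgebra ℝ 𝔸]
    [CompleteSpace 𝔸] (q : ℝ → 𝔸) (h0 : q 0 = 1)
    (hadd : ∀ s t, 0 ≤ s → 0 ≤ t → q (s + t) = q s * q t)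
    (C : ℝ) (hC : ∀ t, 0 ≤ t → ‖q t‖ ≤ C) (hc : Tendsto q (𝓝[>] 0) (𝓝 1)) :
    ∃ G : 𝔸, (fun t => q t - 1 - t • G) =o[𝓝[>] 0] (fun t : ℝ => t) := by
  -- extend the semigroup to a continuous function on the whole line
  set p : ℝ → 𝔸 := fun t => q (max t 0) with hp
  have hC0 : 0 ≤ C := (norm_nonneg _).trans (hC 0 le_rfl)
  have hc' : Tendsto q (𝓝[≥] 0) (𝓝 1) := by
    have : 𝓝[≥] (0 : ℝ) = pure 0 ⊔ 𝓝[>] 0 := by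
      rw [← Set.Ioi_insert, nhdsWithin_insert]
    rw [this, tendsto_sup]
    exact ⟨by rw [← h0]; exact tendsto_pure_nhds _ _, hc⟩
  have hdiff : ∀ s t, 0 ≤ s → s ≤ t → ‖q t - q s‖ ≤ C * ‖q (t - s) - 1‖ := by
    intro s t hs hst
    have : q t - q s = q s * (q (t - s) - 1) := by
      rw [mul_sub, mul_one, ← hadd s (t - s) hs (by linarith)]; congr 2; ring
    rw [this]
    exact (norm_mul_le _ _).trans (mul_le_mul_of_nonneg_right (hC s hs) (norm_nonneg _))
  have hpd : ∀ s t, ‖p t - p s‖ ≤ C * ‖q |max t 0 - max s 0| - 1‖ := by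
    intro s t
    rcases le_total (max s 0) (max t 0) with h | h
    · rw [abs_of_nonneg (by linarith)]
      exact hdiff _ _ (le_max_right _ _) h
    · rw [abs_of_nonpos (by linarith), neg_sub, norm_sub_rev]
      exact hdiff _ _ (le_max_right _ _) h
  have hpc : Continuous p := by
    rw [continuous_iff_continuousAt]
    intro s
    have h1 : Tendsto (fun t : ℝ => |max t 0 - max s 0|) (𝓝 s) (𝓝[≥] 0) := by
      refine tendsto_nhdsWithin_iff.2
        ⟨?_, Eventually.of_forall fun t => Set.mem_Ici.2 (abs_nonneg _)⟩
      have : Continuous (fun t : ℝ => |max t 0 - max s 0|) := by fun_prop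
      simpa using this.tendsto s
    have h2 : Tendsto (fun t => C * ‖q |max t 0 - max s 0| - 1‖) (𝓝 s) (𝓝 0) := by
      have := ((hc'.comp h1).sub_const 1).norm.const_mul C
      simpa using this
    rw [ContinuousAt, tendsto_iff_norm_sub_tendsto_zero]
    exact squeeze_zero (fun _ => norm_nonneg _) (fun t => hpd s t) h2
  set V : ℝ → 𝔸 := fun x => ∫ s in (0 : ℝ)..x, p s with hV
  have hVd : ∀ x, HasDerivAt V (p x) x := fun x =>
    intervalIntegral.integral_hasDerivAt_right (hpc.intervalIntegrable _ _)
      (hpc.stronglyMeasurableAtFilter _ _) hpc.continuousAt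
  have hV0 : V 0 = 0 := by simp [hV]
  have hp0 : p 0 = 1 := by simp [hp, h0]
  -- the averages `V a / a` tend to one, hence some `V a` is invertible
  obtain ⟨a, ha, hVa⟩ : ∃ a : ℝ, 0 < a ∧ IsUnit (V a) := by
    have h1 := (hVd 0).tendsto_slope_zero_right
    simp only [zero_add, hV0, sub_zero, hp0] at h1
    have h2 : ∀ᶠ a : ℝ in 𝓝[>] 0, IsUnit (a⁻¹ • V a) :=
      h1.eventually (Units.isOpen.mem_nhds isUnit_one)
    obtain ⟨a, ha1, ha2⟩ := (h2.and self_mem_nhdsWithin).exists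
    refine ⟨a, ha2, ?_⟩
    have ha0 : (a : ℝ) ≠ 0 := ne_of_gt ha2
    have : V a = algebraMap ℝ 𝔸 a * (a⁻¹ • V a) := by
      rw [← Algebra.smul_def, smul_smul, mul_inv_cancel₀ ha0, one_smul]
    rw [this]
    exact ((isUnit_iff_ne_zero.2 ha0).map (algebraMap ℝ 𝔸)).mul ha1
  obtain ⟨u, hu⟩ := hVa
  have hqV : ∀ h, 0 ≤ h → q h * V a = V (a + h) - V h := by
    intro h hh
    have e1 : q h * V a = ∫ s in (0 : ℝ)..a, q h * p s := by
      exact ((ContinuousLinearMap.mul ℝ 𝔸 (q h)).intervalIntegral_comp_comm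
        (hpc.intervalIntegrable 0 a)).symm
    have e2 : ∫ s in (0 : ℝ)..a, q h * p s = ∫ s in (0 : ℝ)..a, p (s + h) := by
      refine intervalIntegral.integral_congr fun s hs => ?_
      rw [Set.uIcc_of_le ha.le] at hs
      have hs0 := hs.1
      simp only [hp, max_eq_left hs0, max_eq_left (add_nonneg hs0 hh)]
      rw [add_comm, hadd h s hh hs0]
    rw [e1, e2, intervalIntegral.integral_comp_add_right, zero_add]
    exact (intervalIntegral.integral_interval_sub_left (hpc.intervalIntegrable _ _)
      (hpc.intervalIntegrable _ _)).symm
  refine ⟨(p a - 1) * ↑u⁻¹, ?_⟩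
  have hd : HasDerivAt (fun h => (V (a + h) - V h) * ↑u⁻¹) ((p a - 1) * ↑u⁻¹) 0 := by
    have h1 : HasDerivAt (fun h => V (a + h)) (p a) 0 := by
      have := (hVd (a + 0)).comp_const_add a 0
      simpa using this
    have h2 := hVd 0
    rw [hp0] at h2
    exact (h1.sub h2).mul_const _
  have ho := hd.isLittleO.mono (nhdsWithin_le_nhds (s := Set.Ioi 0))
  refine (ho.congr' ?_ ?_)
  · filter_upwards [self_mem_nhdsWithin] with t ht
    have ht' : (0 : ℝ) ≤ t := le_of_lt ht
    have e : (V (a + t) - V t) * ↑u⁻¹ = q t := by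
      rw [← hqV t ht', ← hu, Units.mul_inv_cancel_right]
    simp [e, hV0, ← hu]
  · simp only [sub_zero]; exact Eventually.of_forall fun _ => rfl

end Semigroup

section Flow

variable {E F : Type*} [NormedAddCommGroup E] [NormedSpace ℂ E] [FiniteDimensional ℂ E]
  [NormedAddCommGroup F] [NormedSpace ℂ F] [FiniteDimensional ℂ F]

/-- The generator of a bounded, norm-continuous semigroup of linear maps in finite dimension. -/
theorem exists_generator_of_linear_semigroup (P : ℝ → Module.End ℂ E) (h0 : P 0 = 1)
    (hadd : ∀ s t, 0 ≤ s → 0 ≤ t → P (s + t) = P s * P t) {C : ℝ} (hC : 0 ≤ C)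
    (hb : ∀ t, 0 ≤ t → ∀ x, ‖P t x‖ ≤ C * ‖x‖)
    (hz : ∀ ε : ℝ, 0 < ε → ∀ᶠ t in 𝓝[>] (0 : ℝ), ∀ x, ‖P t x - x‖ ≤ ε * ‖x‖) :
    ∃ G : Module.End ℂ E, ∀ x,
      (fun t => P t x - x - t • G x) =o[𝓝[>] 0] (fun t : ℝ => t) := by
  have : CompleteSpace E := FiniteDimensional.complete ℂ E
  set T := Module.End.toContinuousLinearMap (𝕜 := ℂ) E
  obtain ⟨G, hG⟩ := exists_generator_of_semigroup (fun t => T (P t)) (by simp [h0])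
    (fun s t hs ht => by rw [hadd s t hs ht, map_mul]) C
    (fun t ht => ContinuousLinearMap.opNorm_le_bound _ hC fun x => hb t ht x)
    (by
      rw [Metric.tendsto_nhds]
      intro ε hε
      filter_upwards [hz (ε / 2) (by positivity)] with t ht
      rw [dist_eq_norm]
      exact (ContinuousLinearMap.opNorm_le_bound _ (by positivity) fun x => ht x).trans_lt
        (by linarith))
  refine ⟨G.toLinearMap, fun x => ?_⟩
  have h := (ContinuousLinearMap.apply ℂ E x).isBigO_comp
    (fun t => T (P t) - 1 - t • G) (𝓝[>] 0)
  exact h.trans_isLittleO hG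

/-- The flow `exp (t G)` of a linear map on a finite-dimensional normed space; the exponential is
taken in the Banach algebra of continuous linear maps. -/
noncomputable def expFlow (G : Module.End ℂ E) (t : ℝ) : Module.End ℂ E :=
  (NormedSpace.exp (t • Module.End.toContinuousLinearMap E G) : E →L[ℂ] E).toLinearMap

theorem expFlow_apply (G : Module.End ℂ E) (t : ℝ) (x : E) :
    expFlow G t x = NormedSpace.exp (t • Module.End.toContinuousLinearMap E G) x := rfl

@[simp] theorem expFlow_zero (G : Module.End ℂ E) : expFlow G 0 = 1 := by
  ext x; simp [expFlow]

theorem expFlow_add (G : Module.End ℂ E) (s t : ℝ) :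
    expFlow G (s + t) = expFlow G t * expFlow G s := by
  let _ : NormedAlgebra ℚ (E →L[ℂ] E) := NormedAlgebra.restrictScalars ℚ ℝ _
  have : CompleteSpace E := FiniteDimensional.complete ℂ E
  ext x
  rw [Module.End.mul_apply, expFlow_apply, expFlow_apply, expFlow_apply, add_comm, add_smul,
    NormedSpace.exp_add_of_commute (((Commute.refl _).smul_left _).smul_right _)]
  rfl

theorem hasSum_expFlow (G : Module.End ℂ E) (t : ℝ) (x : E) :
    HasSum (fun n : ℕ => ((n.factorial : ℝ)⁻¹ * t ^ n) • (G ^ n) x) (expFlow G t x) := by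
  have : CompleteSpace E := FiniteDimensional.complete ℂ E
  have h := NormedSpace.exp_series_hasSum_exp' (𝕂 := ℝ)
    (t • Module.End.toContinuousLinearMap E G)
  have h2 : HasSum _ (expFlow G t x) :=
    h.mapL ((ContinuousLinearMap.apply ℂ E x).restrictScalars ℝ)
  have h3 : ∀ n : ℕ, (Module.End.toContinuousLinearMap E G ^ n) x = (G ^ n) x := by
    intro n
    rw [← map_pow]; rfl
  convert h2 using 1
  funext n
  rw [smul_pow, smul_smul]
  simp [h3]

/-- Intertwined generators have intertwined flows. -/
theorem expFlow_intertwine {G : Module.End ℂ E} {G' : Module.End ℂ F} (T : E →ₗ[ℂ] F)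
    (h : ∀ x, T (G x) = G' (T x)) (t : ℝ) (x : E) :
    T (expFlow G t x) = expFlow G' t (T x) := by
  have h1 := (hasSum_expFlow G t x).mapL (T.toContinuousLinearMap.restrictScalars ℝ)
  have hp : ∀ n : ℕ, T ((G ^ n) x) = (G' ^ n) (T x) := by
    intro n
    induction n with
    | zero => simp
    | succ n ih => rw [pow_succ', pow_succ', Module.End.mul_apply, Module.End.mul_apply, h, ih]
  refine HasSum.unique (h1 : HasSum _ (T (expFlow G t x))) ?_
  convert hasSum_expFlow G' t (T x) using 1
  funext n
  rw [← hp]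
  exact (T.toContinuousLinearMap.restrictScalars ℝ).map_smul _ _

/-- A linear functional annihilated by the generator is conserved. -/
theorem expFlow_conserved {G : Module.End ℂ E} (φ : E →ₗ[ℂ] ℂ) (h : ∀ x, φ (G x) = 0)
    (t : ℝ) (x : E) : φ (expFlow G t x) = φ x := by
  rw [expFlow_intertwine (G' := (0 : Module.End ℂ ℂ)) φ (by simpa using h)]
  simp [expFlow]

theorem expFlow_pow (G : Module.End ℂ E) (t : ℝ) (n : ℕ) :
    expFlow G t ^ n = expFlow G (n * t) := by
  induction n with
  | zero => simp
  | succ n ih => rw [pow_succ', ih, ← expFlow_add]; congr 1; push_cast; ring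

theorem expFlow_div_pow (G : Module.End ℂ E) (t : ℝ) {n : ℕ} (hn : n ≠ 0) :
    expFlow G (t / n) ^ n = expFlow G t := by
  rw [expFlow_pow, mul_div_cancel₀ _ (Nat.cast_ne_zero.2 hn)]

theorem hasDerivAt_expFlow (G : Module.End ℂ E) (x : E) (t : ℝ) :
    HasDerivAt (fun s => expFlow G s x) (G (expFlow G t x)) t := by
  have : CompleteSpace E := FiniteDimensional.complete ℂ E
  have h := hasDerivAt_exp_smul_const' (𝕂 := ℝ) (Module.End.toContinuousLinearMap E G) t
  have h2 := ((ContinuousLinearMap.apply ℂ E x).restrictScalars ℝ).hasFDerivAt.comp_hasDerivAt t h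
  exact h2

theorem expFlow_sub_isLittleO (G : Module.End ℂ E) (x : E) :
    (fun t : ℝ => expFlow G t x - x - t • G x) =o[𝓝 0] (fun t : ℝ => t) := by
  have h := (hasDerivAt_expFlow G x 0).isLittleO
  simpa using h

theorem exists_norm_expFlow_le (G : Module.End ℂ E) (t : ℝ) :
    ∃ C, 0 ≤ C ∧ ∀ s, 0 ≤ s → s ≤ t → ∀ x, ‖expFlow G s x‖ ≤ C * ‖x‖ := by
  let _ : NormedAlgebra ℚ (E →L[ℂ] E) := NormedAlgebra.restrictScalars ℚ ℝ _
  have : CompleteSpace E := FiniteDimensional.complete ℂ E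
  have hc : Continuous fun s : ℝ =>
      (NormedSpace.exp (s • Module.End.toContinuousLinearMap E G) : E →L[ℂ] E) :=
    NormedSpace.exp_continuous.comp (continuous_id.smul continuous_const)
  obtain ⟨C, hC⟩ := (isCompact_Icc (a := (0 : ℝ)) (b := t)).exists_bound_of_continuousOn
    hc.continuousOn
  refine ⟨max C 0, le_max_right _ _, fun s h0 hs x => ?_⟩
  exact (ContinuousLinearMap.le_opNorm _ x).trans (mul_le_mul_of_nonneg_right
    ((hC s ⟨h0, hs⟩).trans (le_max_left _ _)) (norm_nonneg _))

omit [FiniteDimensional ℂ E] in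
/-- In finite dimension pointwise `o(·)` for linear maps is uniform. -/
theorem uniform_of_pointwise_isLittleO {ι : Type*} {l : Filter ι} (R : ι → F →ₗ[ℂ] E)
    (g : ι → ℝ) (h : ∀ x, (fun i => R i x) =o[l] g) {ε : ℝ} (hε : 0 < ε) :
    ∀ᶠ i in l, ∀ x, ‖R i x‖ ≤ ε * |g i| * ‖x‖ := by
  set b := Module.finBasis ℂ F
  set n := Module.finrank ℂ F
  have hcoord : ∀ i, ∃ C, 0 ≤ C ∧ ∀ x, ‖b.repr x i‖ ≤ C * ‖x‖ := fun i =>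
    ⟨‖(b.coord i).toContinuousLinearMap‖, norm_nonneg _, fun x =>
      (b.coord i).toContinuousLinearMap.le_opNorm x⟩
  choose C hC0 hC using hcoord
  have hS : 0 ≤ ∑ i, C i := Finset.sum_nonneg fun i _ => hC0 i
  have hε' : 0 < ε / (∑ i, C i + 1) := by positivity
  have hall : ∀ᶠ i in l, ∀ k, ‖R i (b k)‖ ≤ ε / (∑ i, C i + 1) * ‖g i‖ :=
    eventually_all.2 fun k => (h (b k)).def hε'
  filter_upwards [hall] with i hi x
  have hx : R i x = ∑ k, b.repr x k • R i (b k) := by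
    conv_lhs => rw [← b.sum_repr x, map_sum]
    simp only [map_smul]
  calc ‖R i x‖ ≤ ∑ k, ‖b.repr x k • R i (b k)‖ := by rw [hx]; exact norm_sum_le _ _
    _ ≤ ∑ k, C k * (ε / (∑ i, C i + 1) * |g i| * ‖x‖) := by
        refine Finset.sum_le_sum fun k _ => ?_
        rw [norm_smul]
        calc _ ≤ (C k * ‖x‖) * (ε / (∑ i, C i + 1) * ‖g i‖) :=
              mul_le_mul (hC k x) (hi k) (norm_nonneg _)
                (mul_nonneg (hC0 k) (norm_nonneg _))
          _ = _ := by rw [Real.norm_eq_abs]; ring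
    _ = (∑ k, C k) / (∑ i, C i + 1) * (ε * |g i| * ‖x‖) := by rw [← Finset.sum_mul]; ring
    _ ≤ 1 * (ε * |g i| * ‖x‖) := by
        refine mul_le_mul_of_nonneg_right ?_ (by positivity)
        rw [div_le_one (by positivity)]; linarith
    _ = _ := one_mul _

omit [FiniteDimensional ℂ E] [FiniteDimensional ℂ F] in
/-- Telescoping estimate for `Tⁿ B - B sⁿ`. -/
theorem norm_pow_sub_pow_le (T : Module.End ℂ E) (s : Module.End ℂ F) (B : F →ₗ[ℂ] E) (N : ℕ)
    {C D η : ℝ} (hC : 0 ≤ C) (hη : 0 ≤ η) (hT : ∀ j ≤ N, ∀ y, ‖(T ^ j) y‖ ≤ C * ‖y‖)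
    (hs : ∀ j ≤ N, ∀ y, ‖(s ^ j) y‖ ≤ D * ‖y‖)
    (h : ∀ y, ‖T (B y) - B (s y)‖ ≤ η * ‖y‖) (x : F) :
    ‖(T ^ N) (B x) - B ((s ^ N) x)‖ ≤ N * (C * η * D * ‖x‖) := by
  have key : ∀ n m, m + n ≤ N →
      ‖(T ^ m) ((T ^ n) (B x) - B ((s ^ n) x))‖ ≤ n * (C * η * D * ‖x‖) := by
    intro n
    induction n with
    | zero => intro m _; simp
    | succ n ih =>
      intro m hm
      have e : (T ^ m) ((T ^ (n + 1)) (B x) - B ((s ^ (n + 1)) x)) =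
          (T ^ (m + 1)) ((T ^ n) (B x) - B ((s ^ n) x)) +
            (T ^ m) (T (B ((s ^ n) x)) - B (s ((s ^ n) x))) := by
        rw [pow_succ T m, Module.End.mul_apply, ← map_add, pow_succ' T n, pow_succ' s n,
          Module.End.mul_apply, Module.End.mul_apply, map_sub T]
        congr 1; abel
      rw [e]
      have h1 := ih (m + 1) (by omega)
      have h2 : ‖(T ^ m) (T (B ((s ^ n) x)) - B (s ((s ^ n) x)))‖ ≤ C * η * D * ‖x‖ := by
        calc _ ≤ C * ‖T (B ((s ^ n) x)) - B (s ((s ^ n) x))‖ := hT m (by omega) _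
          _ ≤ C * (η * (D * ‖x‖)) := by
            refine mul_le_mul_of_nonneg_left ((h _).trans ?_) hC
            exact mul_le_mul_of_nonneg_left (hs n (by omega) x) hη
          _ = _ := by ring
      calc _ ≤ _ := norm_add_le _ _
        _ ≤ n * (C * η * D * ‖x‖) + C * η * D * ‖x‖ := add_le_add h1 h2
        _ = _ := by push_cast; ring
  simpa using key N 0 (by omega)

omit [FiniteDimensional ℂ E] in
/-- Product formula: if `A` agrees with `1 + t / N • g` up to `o(1 / N)` on the range of `B` and
has bounded powers, then `A ^ N` converges there to the flow of `g`. -/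
theorem tendsto_pow_expFlow (A : ℕ → Module.End ℂ E) (g : Module.End ℂ F) (B : F →ₗ[ℂ] E)
    {t : ℝ} (ht : 0 ≤ t) {C : ℝ} (hC : 0 ≤ C)
    (hA : ∀ᶠ N : ℕ in atTop, ∀ j ≤ N, ∀ y, ‖(A N ^ j) y‖ ≤ C * ‖y‖)
    (h : ∀ x, (fun N : ℕ => A N (B x) - B x - (t / N) • B (g x)) =o[atTop]
      (fun N : ℕ => (N : ℝ)⁻¹)) (x : F) :
    Tendsto (fun N => (A N ^ N) (B x)) atTop (𝓝 (B (expFlow g t x))) := by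
  obtain ⟨D, hD0, hD⟩ := exists_norm_expFlow_le g t
  have hdiv : Tendsto (fun N : ℕ => t / N) atTop (𝓝 0) := tendsto_const_div_atTop_nhds_zero_nat t
  have hR : ∀ y, (fun N : ℕ => (A N ∘ₗ B - B ∘ₗ expFlow g (t / N)) y) =o[atTop]
      (fun N : ℕ => (N : ℝ)⁻¹) := by
    intro y
    have h1 := (expFlow_sub_isLittleO g y).comp_tendsto hdiv
    have h2 : (fun N : ℕ => B (expFlow g (t / N) y - y - (t / N) • g y)) =o[atTop]
        (fun N : ℕ => (N : ℝ)⁻¹) := by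
      refine (((B.toContinuousLinearMap.isBigO_comp _ atTop).trans_isLittleO h1)).trans_isBigO ?_
      refine IsBigO.of_bound |t| (Eventually.of_forall fun N => ?_)
      simp [div_eq_mul_inv]
    refine ((h y).sub h2).congr_left fun N => ?_
    have : B ((t / N) • g y) = (t / N : ℝ) • B (g y) :=
      (B.toContinuousLinearMap.restrictScalars ℝ).map_smul _ _
    simp only [LinearMap.sub_apply, LinearMap.comp_apply, map_sub, this]
    abel
  rw [tendsto_iff_norm_sub_tendsto_zero, Metric.tendsto_nhds]
  intro ε hε
  -- `+ 1` keeps the denominator positive when `C * D * ‖x‖ = 0`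
  have hK : 0 < C * D * ‖x‖ + 1 := by positivity
  have hε' : 0 < ε / (C * D * ‖x‖ + 1) := by positivity
  filter_upwards [hA, uniform_of_pointwise_isLittleO _ _ hR hε', eventually_gt_atTop 0]
    with N hN hu hpos
  have hpos' : (0 : ℝ) < N := Nat.cast_pos.2 hpos
  have h3 := norm_pow_sub_pow_le (A N) (expFlow g (t / N)) B N (D := D) hC
    (η := ε / (C * D * ‖x‖ + 1) * |(N : ℝ)⁻¹|) (by positivity) hN
    (fun j hj y => by
      rw [expFlow_pow]
      refine hD _ (by positivity) ?_ y
      rw [mul_div_assoc', div_le_iff₀ hpos', mul_comm]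
      exact mul_le_mul_of_nonneg_left (Nat.cast_le.2 hj) ht) hu x
  rw [expFlow_div_pow g t hpos.ne'] at h3
  rw [dist_zero_right, norm_norm]
  refine h3.trans_lt ?_
  rw [abs_of_pos (by positivity)]
  calc (N : ℝ) * (C * (ε / (C * D * ‖x‖ + 1) * (N : ℝ)⁻¹) * D * ‖x‖)
      = ε * ((C * D * ‖x‖) / (C * D * ‖x‖ + 1)) := by field_simp
    _ < ε * 1 := by
        refine mul_lt_mul_of_pos_left ?_ hε
        rw [div_lt_one hK]; linarith
    _ = ε := mul_one _

/-- A linear perturbation of the identity of order `δ + δ²`, iterated `N` times at `δ = t / N`,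
has uniformly bounded powers. -/
theorem exists_norm_pow_le (G R : Module.End ℂ E) {t : ℝ} (ht : 0 ≤ t) :
    ∃ C, 0 ≤ C ∧ ∀ N : ℕ, 0 < N → ∀ j ≤ N, ∀ y,
      ‖((1 + ((t / N : ℝ) : ℂ) • G + ((t / N : ℝ) : ℂ) ^ 2 • R) ^ j) y‖ ≤ C * ‖y‖ := by
  set a := ‖LinearMap.toContinuousLinearMap G‖
  set b := ‖LinearMap.toContinuousLinearMap R‖
  have ha : ∀ y, ‖G y‖ ≤ a * ‖y‖ := (LinearMap.toContinuousLinearMap G).le_opNorm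
  have hb : ∀ y, ‖R y‖ ≤ b * ‖y‖ := (LinearMap.toContinuousLinearMap R).le_opNorm
  have ha0 : 0 ≤ a := norm_nonneg _
  have hb0 : 0 ≤ b := norm_nonneg _
  set c := t * a + t ^ 2 * b
  have hc : 0 ≤ c := by positivity
  refine ⟨Real.exp c, (Real.exp_pos _).le, fun N hN j hj y => ?_⟩
  have hN1 : (1 : ℝ) ≤ N := by exact_mod_cast hN
  have hN0 : (0 : ℝ) < N := by linarith
  set T : Module.End ℂ E := 1 + ((t / N : ℝ) : ℂ) • G + ((t / N : ℝ) : ℂ) ^ 2 • R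
  have h1 : ∀ y, ‖T y‖ ≤ (1 + c / N) * ‖y‖ := by
    intro y
    have e : T y = y + ((t / N : ℝ) : ℂ) • G y + ((t / N : ℝ) : ℂ) ^ 2 • R y := by simp [T]
    have hn : ‖((t / N : ℝ) : ℂ)‖ = t / N := by
      rw [Complex.norm_real, Real.norm_of_nonneg (by positivity)]
    have hsq : (t / N) ^ 2 ≤ t ^ 2 / N := by
      rw [div_pow]
      refine div_le_div_of_nonneg_left (by positivity) hN0 ?_
      nlinarith
    calc ‖T y‖ ≤ ‖y‖ + t / N * ‖G y‖ + (t / N) ^ 2 * ‖R y‖ := by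
          rw [e]
          refine (norm_add₃_le).trans_eq ?_
          rw [norm_smul, norm_smul, norm_pow, hn]
      _ ≤ ‖y‖ + t / N * (a * ‖y‖) + t ^ 2 / N * (b * ‖y‖) := by
          have := ha y; have := hb y
          gcongr
      _ = _ := by simp only [c]; ring
  have h2 : ∀ j : ℕ, ∀ y, ‖(T ^ j) y‖ ≤ (1 + c / N) ^ j * ‖y‖ := by
    intro j
    induction j with
    | zero => intro y; simp
    | succ j ih =>
      intro y
      rw [pow_succ', Module.End.mul_apply, pow_succ', mul_assoc]
      exact (h1 _).trans (mul_le_mul_of_nonneg_left (ih y) (by positivity))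
  refine (h2 j y).trans (mul_le_mul_of_nonneg_right ?_ (norm_nonneg _))
  have hcN : 0 ≤ c / N := by positivity
  calc (1 + c / N) ^ j ≤ (1 + c / N) ^ N := pow_le_pow_right₀ (by linarith) hj
    _ ≤ Real.exp (c / N) ^ N := by
        refine pow_le_pow_left₀ (by linarith) ?_ _
        rw [add_comm]; exact Real.add_one_le_exp _
    _ = Real.exp c := by rw [← Real.exp_nat_mul, mul_div_cancel₀ _ hN0.ne']

/-- The Euler scheme with a quadratic correction converges to the flow. -/
theorem tendsto_euler_expFlow (G R : Module.End ℂ E) {t : ℝ} (ht : 0 ≤ t) (x : E) :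
    Tendsto (fun N : ℕ =>
      ((1 + ((t / N : ℝ) : ℂ) • G + ((t / N : ℝ) : ℂ) ^ 2 • R) ^ N) x) atTop
      (𝓝 (expFlow G t x)) := by
  obtain ⟨C, hC, h⟩ := exists_norm_pow_le G R ht
  refine tendsto_pow_expFlow _ G LinearMap.id ht hC
    ((eventually_gt_atTop 0).mono fun N hN => h N hN) (fun y => ?_) x
  have e : ∀ N : ℕ, (1 + ((t / N : ℝ) : ℂ) • G + ((t / N : ℝ) : ℂ) ^ 2 • R) y - y
      - (t / N) • G y = ((t / N : ℝ) : ℂ) ^ 2 • R y := by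
    intro N
    rw [← Complex.coe_smul (t / N)]
    simp only [LinearMap.add_apply, LinearMap.smul_apply, Module.End.one_apply]
    abel
  have h1 : Tendsto (fun N : ℕ => (N : ℝ)⁻¹) atTop (𝓝 0) := tendsto_inv_atTop_nhds_zero_nat
  have h2 : (fun N : ℕ => (N : ℝ)⁻¹ ^ 2) =o[atTop] (fun N : ℕ => (N : ℝ)⁻¹) := by
    have := (isLittleO_pow_id (𝕜 := ℝ) (n := 2) (by norm_num)).comp_tendsto h1
    simpa [Function.comp_def] using this
  refine (IsBigO.of_bound (t ^ 2 * ‖R y‖) (Eventually.of_forall fun N => ?_)).trans_isLittleO h2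
  simp only [LinearMap.id_apply]
  rw [e, norm_smul, norm_pow, Complex.norm_real, norm_pow, Real.norm_eq_abs, Real.norm_eq_abs,
    sq_abs, sq_abs, div_pow]
  exact le_of_eq (by rw [inv_pow]; ring)

end Flow

/-! ### Positivity and completely positive maps -/

theorem posSemidef_of_tendsto {ι α : Type*} [Fintype ι] {l : Filter α} [l.NeBot]
    {f : α → Matrix ι ι ℂ} {A : Matrix ι ι ℂ} (hf : Tendsto f l (𝓝 A))
    (h : ∀ᶠ a in l, (f a).PosSemidef) : A.PosSemidef := by
  rw [Matrix.posSemidef_iff_dotProduct_mulVec]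
  refine ⟨?_, fun x => ?_⟩
  · have h1 : Tendsto (fun a => (f a)ᴴ) l (𝓝 Aᴴ) :=
      (continuous_id.matrix_conjTranspose.tendsto A).comp hf
    exact tendsto_nhds_unique_of_eventuallyEq h1 hf (h.mono fun a ha => ha.1)
  · have hc : Continuous fun B : Matrix ι ι ℂ => star x ⬝ᵥ (B *ᵥ x) :=
      continuous_const.dotProduct (continuous_id.matrix_mulVec continuous_const)
    exact ge_of_tendsto ((hc.tendsto A).comp hf) (h.mono fun a ha => ha.dotProduct_mulVec_nonneg x)

/-- Entries of a positive semidefinite matrix are bounded by its trace. -/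
theorem norm_apply_le_trace {ι : Type*} [Fintype ι] {A : Matrix ι ι ℂ}
    (hA : A.PosSemidef) (i j : ι) : ‖A i j‖ ≤ A.trace.re := by
  classical
  have hdiag : ∀ k, 0 ≤ (A k k).re := fun k => (Complex.nonneg_iff.1 hA.diag_nonneg).1
  have htr : A.trace.re = ∑ k, (A k k).re := by simp [Matrix.trace]
  have hle : ∀ k, (A k k).re ≤ A.trace.re := fun k => by
    rw [htr]; exact Finset.single_le_sum (fun k _ => hdiag k) (Finset.mem_univ k)
  -- the `2 × 2` principal minor is nonnegative
  have h2 := (hA.submatrix ![i, j]).det_nonneg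
  rw [Matrix.det_fin_two] at h2
  simp only [Matrix.submatrix_apply, Matrix.cons_val_zero, Matrix.cons_val_one] at h2
  have hji : A j i = star (A i j) := (hA.1.apply i j).symm ▸ by simp
  have hii : ∀ k, A k k = ((A k k).re : ℂ) := fun k =>
    Complex.ext rfl (by simpa using (Complex.nonneg_iff.1 (hA.diag_nonneg (i := k))).2.symm)
  have h3 := (Complex.nonneg_iff.1 h2).1
  rw [hji, hii i, hii j, Complex.star_def, Complex.mul_conj, ← Complex.ofReal_mul,
    ← Complex.ofReal_sub, Complex.ofReal_re, Complex.normSq_eq_norm_sq] at h3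
  have h4 := hle i
  have h5 := hle j
  have h0 : 0 ≤ A.trace.re := (hdiag i).trans h4
  refine abs_le_of_sq_le_sq' ?_ h0 |>.2
  nlinarith [mul_le_mul h4 h5 (hdiag j) h0]

section CP

variable {ι : Type*}

/-- Complete positivity: all ampliations preserve positive semidefiniteness. -/
def IsCP (Φ : Module.End ℂ (Matrix ι ι ℂ)) : Prop :=
  ∀ (n : ℕ) (X : Matrix (ι × Fin n) (ι × Fin n) ℂ),
    X.PosSemidef → (ampliation n Φ X).PosSemidef

namespace IsCP

variable {Φ Ψ : Module.End ℂ (Matrix ι ι ℂ)}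

theorem add (h : IsCP Φ) (h' : IsCP Ψ) : IsCP (Φ + Ψ) :=
  fun n X hX => (h n X hX).add (h' n X hX)

theorem sum {κ : Type*} (s : Finset κ) {Φ : κ → Module.End ℂ (Matrix ι ι ℂ)}
    (h : ∀ k ∈ s, IsCP (Φ k)) : IsCP (∑ k ∈ s, Φ k) := by
  classical
  induction s using Finset.induction_on with
  | empty =>
    intro n X _
    have : ampliation n (0 : Module.End ℂ (Matrix ι ι ℂ)) X = 0 := rfl
    simpa [this] using Matrix.PosSemidef.zero
  | insert a s ha ih =>
    rw [Finset.sum_insert ha]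
    exact (h a (Finset.mem_insert_self _ _)).add (ih fun k hk => h k (Finset.mem_insert_of_mem hk))

theorem smul {c : ℂ} (hc : 0 ≤ c) (h : IsCP Φ) : IsCP (c • Φ) :=
  fun n X hX => (h n X hX).smul hc

theorem mul (h : IsCP Φ) (h' : IsCP Ψ) : IsCP (Φ * Ψ) :=
  fun n X hX => h n _ (h' n X hX)

theorem one : IsCP (1 : Module.End ℂ (Matrix ι ι ℂ)) := fun _ _ hX => hX

theorem pow (h : IsCP Φ) (k : ℕ) : IsCP (Φ ^ k) := by
  induction k with
  | zero => exact one
  | succ k ih => rw [pow_succ]; exact ih.mul h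

theorem of_tendsto [Fintype ι] {α : Type*} {l : Filter α} [l.NeBot] {f : α → Module.End ℂ (Matrix ι ι ℂ)}
    (hf : ∀ X, Tendsto (fun a => f a X) l (𝓝 (Φ X))) (h : ∀ᶠ a in l, IsCP (f a)) : IsCP Φ := by
  intro n X hX
  refine posSemidef_of_tendsto (f := fun a => ampliation n (f a) X) (l := l) ?_
    (h.mono fun a ha => ha n X hX)
  refine tendsto_pi_nhds.2 fun p => tendsto_pi_nhds.2 fun q => ?_
  exact (tendsto_pi_nhds.1 (tendsto_pi_nhds.1 (hf _) p.1)) q.1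

theorem posSemidef (h : IsCP Φ) {X : Matrix ι ι ℂ} (hX : X.PosSemidef) : (Φ X).PosSemidef :=
  (h 1 (X.submatrix Prod.fst Prod.fst) (hX.submatrix _)).submatrix (fun i => (i, 0))

end IsCP

variable [Fintype ι]

/-- Conjugation `X ↦ V X V†`. -/
def conjMap (V : Matrix ι ι ℂ) : Module.End ℂ (Matrix ι ι ℂ) where
  toFun X := V * X * Vᴴ
  map_add' X Y := by rw [mul_add, add_mul]
  map_smul' c X := by simp

@[simp] theorem conjMap_apply (V X : Matrix ι ι ℂ) : conjMap V X = V * X * Vᴴ := rfl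

theorem isCP_conjMap (V : Matrix ι ι ℂ) : IsCP (conjMap V) := by
  classical
  intro n X hX
  have : ampliation n (conjMap V) X =
      (V ⊗ₖ (1 : Matrix (Fin n) (Fin n) ℂ)) * X * (V ⊗ₖ (1 : Matrix (Fin n) (Fin n) ℂ))ᴴ := by
    ext p q
    change (V * X.submatrix (fun i => (i, p.2)) (fun j => (j, q.2)) * Vᴴ) p.1 q.1 = _
    simp [Matrix.mul_apply, Fintype.sum_prod_type, Matrix.one_apply,
      Finset.sum_mul, apply_ite, ite_mul]
  rw [this]
  exact hX.mul_mul_conjTranspose_same _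

theorem IsQuantumChannel.pow {Φ : Module.End ℂ (Matrix ι ι ℂ)} (h : IsQuantumChannel Φ) (k : ℕ) :
    IsQuantumChannel (Φ ^ k) := by
  refine ⟨IsCP.pow h.1 k, ?_⟩
  induction k with
  | zero => intro X; simp
  | succ k ih => intro X; rw [pow_succ', Module.End.mul_apply, h.2, ih]

/-- The states span all matrices, by polarization of `|eᵢ⟩⟨eⱼ|`. -/
theorem span_isState : Submodule.span ℂ {ρ : Matrix ι ι ℂ | IsState ρ} = ⊤ := by
  classical
  set S := Submodule.span ℂ {ρ : Matrix ι ι ℂ | IsState ρ}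
  have hpsd : ∀ A : Matrix ι ι ℂ, A.PosSemidef → A ∈ S := by
    intro A hA
    by_cases h0 : A.trace = 0
    · rw [hA.trace_eq_zero_iff.1 h0]; exact S.zero_mem
    · have hst : IsState (A.trace⁻¹ • A) := by
        refine ⟨hA.smul ?_, by simp [h0]⟩
        exact inv_nonneg.2 hA.trace_nonneg
      have := S.smul_mem A.trace (Submodule.subset_span hst)
      rwa [smul_smul, mul_inv_cancel₀ h0, one_smul] at this
  have hv : ∀ v : ι → ℂ, Matrix.vecMulVec v (star v) ∈ S := fun v =>
    hpsd _ (Matrix.posSemidef_vecMulVec_self_star v)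
  rw [eq_top_iff]
  intro X _
  rw [Matrix.matrix_eq_sum_single X]
  refine S.sum_mem fun i _ => S.sum_mem fun j _ => ?_
  have hij : Matrix.single i j (1 : ℂ) ∈ S := by
    set e : ι → ℂ := Pi.single i 1
    set f : ι → ℂ := Pi.single j 1
    have e1 : Matrix.single i j (1 : ℂ) = (1 / 4 : ℂ) •
        (Matrix.vecMulVec (e + f) (star (e + f)) - Matrix.vecMulVec (e - f) (star (e - f)) +
          Complex.I • (Matrix.vecMulVec (e + Complex.I • f) (star (e + Complex.I • f)) -
            Matrix.vecMulVec (e - Complex.I • f) (star (e - Complex.I • f)))) := by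
      have hs : Matrix.single i j (1 : ℂ) = Matrix.vecMulVec e (star f) := by
        ext a b
        simp [e, f, Matrix.single, Matrix.vecMulVec_apply, Pi.single_apply, eq_comm, ite_and]
        split_ifs <;> rfl
      rw [hs]
      ext a b
      simp only [Matrix.vecMulVec_apply, Matrix.smul_apply, Matrix.add_apply, Matrix.sub_apply,
        Pi.add_apply, Pi.sub_apply, Pi.star_apply, star_add, star_sub, star_smul, smul_eq_mul,
        Pi.smul_apply, Complex.star_def, Complex.conj_I]
      linear_combination ((1/2) * e a * (starRingEnd ℂ) (f b)
        - (1/2) * f a * (starRingEnd ℂ) (e b)) * Complex.I_mul_I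
    rw [e1]
    exact S.smul_mem _ (S.add_mem (S.sub_mem (hv _) (hv _))
      (S.smul_mem _ (S.sub_mem (hv _) (hv _))))
  have := S.smul_mem (X i j) hij
  simpa [Matrix.smul_single] using this

/-- All channels on a given space share a norm bound: they map states, which span, to states. -/
theorem exists_norm_channel_le (ι : Type*) [Fintype ι] :
    ∃ C, 0 ≤ C ∧ ∀ Φ : Module.End ℂ (Matrix ι ι ℂ), IsQuantumChannel Φ →
      ∀ X, ‖Φ X‖ ≤ C * ‖X‖ := by
  classical
  have hst : ∀ X : Matrix ι ι ℂ, ∃ C, ∀ Φ : Module.End ℂ (Matrix ι ι ℂ), IsQuantumChannel Φ →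
      ‖Φ X‖ ≤ C := by
    intro X
    have hX : X ∈ Submodule.span ℂ {ρ : Matrix ι ι ℂ | IsState ρ} := by
      rw [span_isState]; trivial
    induction hX using Submodule.span_induction with
    | mem ρ hρ =>
      refine ⟨1, fun Φ hΦ => ?_⟩
      rw [Matrix.norm_le_iff zero_le_one]
      intro i j
      refine (norm_apply_le_trace (IsCP.posSemidef hΦ.1 hρ.1) i j).trans_eq ?_
      rw [hΦ.2, hρ.2, Complex.one_re]
    | zero => exact ⟨0, fun Φ _ => by simp⟩
    | add x y _ _ hx hy =>
      obtain ⟨a, ha⟩ := hx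
      obtain ⟨b, hb⟩ := hy
      exact ⟨a + b, fun Φ hΦ => by
        rw [map_add]; exact (norm_add_le _ _).trans (add_le_add (ha Φ hΦ) (hb Φ hΦ))⟩
    | smul c x _ hx =>
      obtain ⟨a, ha⟩ := hx
      exact ⟨‖c‖ * a, fun Φ hΦ => by
        rw [map_smul, norm_smul]
        exact mul_le_mul_of_nonneg_left (ha Φ hΦ) (norm_nonneg _)⟩
  choose C hC using fun p : ι × ι => hst (Matrix.single p.1 p.2 1)
  refine ⟨∑ p, |C p|, Finset.sum_nonneg fun _ _ => abs_nonneg _, fun Φ hΦ X => ?_⟩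
  conv_lhs => rw [Matrix.matrix_eq_sum_single X, ← Fintype.sum_prod_type', map_sum]
  rw [Finset.sum_mul]
  refine (norm_sum_le _ _).trans (Finset.sum_le_sum fun p _ => ?_)
  have : Matrix.single p.1 p.2 (X p.1 p.2) = X p.1 p.2 • Matrix.single p.1 p.2 (1 : ℂ) := by
    simp [Matrix.smul_single]
  rw [this, map_smul, norm_smul, mul_comm]
  exact mul_le_mul ((hC p Φ hΦ).trans (le_abs_self _)) (Matrix.norm_entry_le_entrywise_sup_norm X)
    (norm_nonneg _) (abs_nonneg _)

/-- The generator `X ↦ K X + X K† + ∑ V X V†`. -/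
def lindbladMap {κ : Type*} [Fintype κ] (K : Matrix ι ι ℂ) (V : κ → Matrix ι ι ℂ) :
    Module.End ℂ (Matrix ι ι ℂ) :=
  LinearMap.mulLeft ℂ K + LinearMap.mulRight ℂ Kᴴ + ∑ j, conjMap (V j)

theorem lindbladMap_apply {κ : Type*} [Fintype κ] (K : Matrix ι ι ℂ) (V : κ → Matrix ι ι ℂ)
    (X : Matrix ι ι ℂ) : lindbladMap K V X = K * X + X * Kᴴ + ∑ j, V j * X * (V j)ᴴ := by
  simp [lindbladMap, LinearMap.sum_apply]

theorem trace_lindbladMap {κ : Type*} [Fintype κ] (K : Matrix ι ι ℂ) (V : κ → Matrix ι ι ℂ)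
    (X : Matrix ι ι ℂ) :
    (lindbladMap K V X).trace = ((K + Kᴴ + ∑ j, (V j)ᴴ * V j) * X).trace := by
  rw [lindbladMap_apply, add_mul, add_mul, Finset.sum_mul, Matrix.trace_add, Matrix.trace_add,
    Matrix.trace_add, Matrix.trace_add, Matrix.trace_sum, Matrix.trace_sum,
    Matrix.trace_mul_comm X]
  congr 1
  refine Finset.sum_congr rfl fun j _ => ?_
  rw [Matrix.trace_mul_comm, Matrix.mul_assoc]

/-- The flow of a Lindblad generator consists of channels: it is the limit of iterates of the
completely positive maps `X ↦ (1 + δ K) X (1 + δ K)† + δ ∑ V X V†`. -/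
theorem isQuantumChannel_expFlow_lindbladMap {κ : Type*} [Fintype κ] (K : Matrix ι ι ℂ)
    (V : κ → Matrix ι ι ℂ) (hK : K + Kᴴ + ∑ j, (V j)ᴴ * V j = 0) {t : ℝ} (ht : 0 ≤ t) :
    IsQuantumChannel (expFlow (lindbladMap K V) t) := by
  classical
  constructor
  · refine IsCP.of_tendsto (tendsto_euler_expFlow (lindbladMap K V) (conjMap K) ht)
      (Eventually.of_forall fun N => IsCP.pow ?_ N)
    have hδ : (0 : ℂ) ≤ ((t / N : ℝ) : ℂ) := by exact_mod_cast (by positivity : (0:ℝ) ≤ t / N)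
    generalize (t / N : ℝ) = δ at hδ
    have e : 1 + (δ : ℂ) • lindbladMap K V + (δ : ℂ) ^ 2 • conjMap K =
        conjMap (1 + (δ : ℂ) • K) + (δ : ℂ) • ∑ j, conjMap (V j) := by
      refine LinearMap.ext fun X => ?_
      simp only [LinearMap.add_apply, LinearMap.smul_apply, Module.End.one_apply,
        lindbladMap_apply, conjMap_apply, LinearMap.sum_apply, Matrix.conjTranspose_add,
        Matrix.conjTranspose_one, Matrix.conjTranspose_smul, Complex.star_def,
        Complex.conj_ofReal, add_mul, mul_add, one_mul, mul_one, smul_mul_assoc,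
        mul_smul_comm, smul_add, smul_smul, pow_two]
      abel
    rw [e]
    exact (isCP_conjMap _).add ((IsCP.sum _ fun j _ => isCP_conjMap _).smul hδ)
  · intro X
    exact expFlow_conserved (Matrix.traceLinearMap ι ℂ ℂ) (fun Y => by
      rw [Matrix.traceLinearMap_apply, trace_lindbladMap, hK]; simp) t X

end CP

/-! ### Choi matrices, Kraus operators and generators of completely positive families -/

section Choi

variable {d : ℕ}

/-- The Choi matrix of a linear map, with entries `⟨a| E(|i⟩⟨j|) |b⟩` at `(i, a), (j, b)`. -/
def choi (E : Module.End ℂ (ClockworkOp d)) : Matrix (Fin d × Fin d) (Fin d × Fin d) ℂ :=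
  fun p q => E (Matrix.single p.1 q.1 1) p.2 q.2

theorem apply_eq_sum_choi (E : Module.End ℂ (ClockworkOp d)) (X : ClockworkOp d) (a b : Fin d) :
    E X a b = ∑ i, ∑ j, X i j * choi E (i, a) (j, b) := by
  conv_lhs => rw [Matrix.matrix_eq_sum_single X]
  simp only [map_sum, Matrix.sum_apply]
  refine Finset.sum_congr rfl fun i _ => Finset.sum_congr rfl fun j _ => ?_
  have : Matrix.single i j (X i j) = X i j • Matrix.single i j (1 : ℂ) := by
    simp [Matrix.smul_single]
  rw [this, map_smul]; rfl

/-- A factorization `B† B` of a Choi matrix yields the Kraus operators, one for each row. -/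
theorem sum_mul_conjTranspose_mul_self (B : Matrix (Fin d × Fin d) (Fin d × Fin d) ℂ)
    (X : ClockworkOp d) (a b : Fin d) :
    ∑ i, ∑ j, X i j * (Bᴴ * B) (i, a) (j, b) =
      (∑ r, (Matrix.of fun a i => star (B r (i, a))) * X *
        (Matrix.of fun a i => star (B r (i, a)))ᴴ : ClockworkOp d) a b := by
  simp only [Matrix.sum_apply, Matrix.mul_apply, Matrix.conjTranspose_apply, Matrix.of_apply,
    star_star, Finset.mul_sum, Finset.sum_mul]
  rw [Finset.sum_congr rfl fun i _ => Finset.sum_comm, Finset.sum_comm]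
  refine Finset.sum_congr rfl fun r _ => ?_
  rw [Finset.sum_comm]
  exact Finset.sum_congr rfl fun j _ => Finset.sum_congr rfl fun i _ => by ring

open scoped MatrixOrder in
theorem exists_eq_conjTranspose_mul_self {ι : Type*} [Fintype ι] {A : Matrix ι ι ℂ}
    (hA : A.PosSemidef) : ∃ B : Matrix ι ι ℂ, A = Bᴴ * B := by
  classical
  refine ⟨CFC.sqrt A, ?_⟩
  rw [(Matrix.nonneg_iff_posSemidef.1 (CFC.sqrt_nonneg A)).1.eq, ← sq, CFC.sq_sqrt A hA.nonneg]

theorem exists_kraus (E : Module.End ℂ (ClockworkOp d)) (h : (choi E).PosSemidef) :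
    ∃ V : Fin d × Fin d → ClockworkOp d, ∀ X, E X = ∑ r, V r * X * (V r)ᴴ := by
  obtain ⟨B, hB⟩ := exists_eq_conjTranspose_mul_self h
  refine ⟨fun r => Matrix.of fun a i => star (B r (i, a)), fun X => ?_⟩
  ext a b
  rw [apply_eq_sum_choi, hB, sum_mul_conjTranspose_mul_self]

theorem tendsto_choi {α : Type*} {l : Filter α} {f : α → Module.End ℂ (ClockworkOp d)}
    {E : Module.End ℂ (ClockworkOp d)} (h : ∀ X, Tendsto (fun a => f a X) l (𝓝 (E X))) :
    Tendsto (fun a => choi (f a)) l (𝓝 (choi E)) :=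
  tendsto_pi_nhds.2 fun _ => tendsto_pi_nhds.2 fun _ =>
    tendsto_pi_nhds.1 (tendsto_pi_nhds.1 (h _) _) _

theorem tendsto_inv_smul_of_isLittleO {W : Type*} [NormedAddCommGroup W] [NormedSpace ℂ W]
    {f : ℝ → W} {e : W} (h : (fun t => f t - t • e) =o[𝓝[>] 0] (fun t : ℝ => t)) :
    Tendsto (fun t : ℝ => t⁻¹ • f t) (𝓝[>] 0) (𝓝 e) := by
  have h1 := h.tendsto_inv_smul_nhds_zero
  have h2 : Tendsto (fun t : ℝ => t⁻¹ • (f t - t • e) + e) (𝓝[>] 0) (𝓝 e) := by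
    simpa using h1.add_const e
  refine h2.congr' ?_
  filter_upwards [self_mem_nhdsWithin] with t ht
  rw [smul_sub, smul_smul, inv_mul_cancel₀ (ne_of_gt ht), one_smul, sub_add_cancel]

/-- A generator of completely positive maps `Φ t = t E + o(t)` is completely positive. -/
theorem choi_posSemidef_of_isLittleO {E : Module.End ℂ (ClockworkOp d)}
    {Φ : ℝ → Module.End ℂ (ClockworkOp d)} (hΦ : ∀ t, 0 ≤ t → (choi (Φ t)).PosSemidef)
    (h : ∀ X, (fun t => Φ t X - t • E X) =o[𝓝[>] 0] (fun t : ℝ => t)) :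
    (choi E).PosSemidef := by
  have h1 : Tendsto (fun t : ℝ => choi ((t⁻¹ : ℂ) • Φ t)) (𝓝[>] 0) (𝓝 (choi E)) := by
    refine tendsto_choi fun X => ?_
    refine (tendsto_inv_smul_of_isLittleO (h X)).congr fun t => ?_
    rw [LinearMap.smul_apply, ← Complex.ofReal_inv, Complex.coe_smul]
  refine posSemidef_of_tendsto h1 ?_
  filter_upwards [self_mem_nhdsWithin] with t ht
  have ht0 : (0 : ℂ) ≤ (t : ℂ)⁻¹ := by
    rw [← Complex.ofReal_inv]
    exact_mod_cast inv_nonneg.2 (le_of_lt ht)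
  exact (hΦ t (le_of_lt ht)).smul ht0

/-- Lindblad's theorem for the clockwork: if the completely positive maps `Φ t` are
`1 + t E + o(t)`, then `E X = K X + X K† + ∑ V X V†`.

Let `Q` be the projection onto the orthogonal complement of `Ω = ∑ |i⟩|i⟩`.  The Choi matrix of
the identity is `Ω Ω†`, so `Q C(Φ t) Q = t Q C(E) Q + o(t)`, and `Q C(E) Q` is positive
semidefinite; it supplies the operators `V`.  The difference `C(E) - Q C(E) Q` has the form
`w Ω† + Ω w†`, which is the Choi matrix of `X ↦ K X + X K†`. -/
theorem exists_lindblad_form (hd : 0 < d) {E : Module.End ℂ (ClockworkOp d)}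
    {Φ : ℝ → Module.End ℂ (ClockworkOp d)} (hΦ : ∀ t, 0 ≤ t → (choi (Φ t)).PosSemidef)
    (h : ∀ X, (fun t => Φ t X - X - t • E X) =o[𝓝[>] 0] (fun t : ℝ => t)) :
    ∃ (K : ClockworkOp d) (V : Fin d × Fin d → ClockworkOp d), E = lindbladMap K V := by
  have hd0 : (d : ℂ) ≠ 0 := by exact_mod_cast hd.ne'
  set C := choi E with hC
  have hlim : Tendsto (fun t : ℝ => choi (((t : ℂ)⁻¹) • (Φ t - 1))) (𝓝[>] 0) (𝓝 C) := by
    refine tendsto_choi fun X => ?_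
    refine (tendsto_inv_smul_of_isLittleO (h X)).congr fun t => ?_
    rw [LinearMap.smul_apply, ← Complex.ofReal_inv, Complex.coe_smul]
    rfl
  have hsplit : ∀ t : ℝ, choi (((t : ℂ)⁻¹) • (Φ t - 1)) =
      ((t : ℂ)⁻¹) • (choi (Φ t) - choi (1 : Module.End ℂ (ClockworkOp d))) := fun t => rfl
  -- the Choi matrix of the identity
  have hone : choi (1 : Module.End ℂ (ClockworkOp d)) =
      Matrix.of fun p q => if p.1 = p.2 ∧ q.1 = q.2 then 1 else 0 := by
    ext p q
    simp [choi, Matrix.single_apply]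
  have honeH : (choi (1 : Module.End ℂ (ClockworkOp d))).IsHermitian := by
    rw [hone]
    ext p q
    simp [Matrix.conjTranspose_apply, and_comm, apply_ite]
  have hCH : Cᴴ = C := by
    refine tendsto_nhds_unique_of_eventuallyEq
      ((continuous_id.matrix_conjTranspose.tendsto C).comp hlim) hlim ?_
    filter_upwards [self_mem_nhdsWithin] with t ht
    simp only [Function.comp_apply, id, hsplit, Matrix.conjTranspose_smul,
      Matrix.conjTranspose_sub, (hΦ t (le_of_lt ht)).1.eq, honeH.eq]
    simp
  set R : Matrix (Fin d × Fin d) (Fin d × Fin d) ℂ :=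
    Matrix.of fun p q => if p.1 = p.2 ∧ q.1 = q.2 then (d : ℂ)⁻¹ else 0 with hR
  have hRH : Rᴴ = R := by
    ext p q
    simp only [hR, Matrix.conjTranspose_apply, Matrix.of_apply, and_comm, apply_ite star,
      star_inv₀, star_natCast, star_zero]
  have hQ1 : (1 - R) * choi (1 : Module.End ℂ (ClockworkOp d)) = 0 := by
    rw [hone]
    ext p q
    rw [sub_mul, one_mul]
    simp [hR, Matrix.mul_apply, Fintype.sum_prod_type, ite_and, hd0]
    split_ifs <;> simp
  have hQ : ((1 - R)ᴴ * C * (1 - R)).PosSemidef := by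
    have h1 : Tendsto (fun t : ℝ => (1 - R)ᴴ * choi (((t : ℂ)⁻¹) • (Φ t - 1)) * (1 - R))
        (𝓝[>] 0) (𝓝 ((1 - R)ᴴ * C * (1 - R))) := by
      have hc : Continuous fun A : Matrix (Fin d × Fin d) (Fin d × Fin d) ℂ =>
          (1 - R)ᴴ * A * (1 - R) :=
        (continuous_const.matrix_mul continuous_id).matrix_mul continuous_const
      exact (hc.tendsto C).comp hlim
    refine posSemidef_of_tendsto h1 ?_
    filter_upwards [self_mem_nhdsWithin] with t ht
    have ht0 : (0 : ℂ) ≤ (t : ℂ)⁻¹ := by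
      rw [← Complex.ofReal_inv]
      exact_mod_cast inv_nonneg.2 (le_of_lt ht)
    have e : (1 - R)ᴴ * choi (((t : ℂ)⁻¹) • (Φ t - 1)) * (1 - R) =
        (t : ℂ)⁻¹ • ((1 - R)ᴴ * choi (Φ t) * (1 - R)) := by
      have hQH : (1 - R)ᴴ = 1 - R := by rw [Matrix.conjTranspose_sub, hRH]; simp
      rw [hsplit, Matrix.mul_smul, Matrix.smul_mul, hQH,
        Matrix.mul_sub (1 - R) (choi (Φ t)), hQ1, sub_zero]
    rw [e]
    exact ((hΦ t (le_of_lt ht)).conjTranspose_mul_mul_same _).smul ht0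
  obtain ⟨B, hB⟩ := exists_eq_conjTranspose_mul_self hQ
  rw [Matrix.conjTranspose_sub, hRH, Matrix.conjTranspose_one] at hB
  have hCe : ∀ p q, star (C p q) = C q p := fun p q => by
    conv_rhs => rw [← hCH]
    rfl
  set s : ℂ := (d : ℂ)⁻¹ * ((d : ℂ)⁻¹ * ∑ k, ∑ l, C (k, k) (l, l)) with hs
  have hsr : star s = s := by
    simp only [hs, star_mul', star_inv₀, star_natCast, star_sum, hCe]
    rw [Finset.sum_comm]
  set K : ClockworkOp d := Matrix.of fun a i =>
    (d : ℂ)⁻¹ * ∑ k, C (i, a) (k, k) - s / 2 * (if a = i then 1 else 0) with hK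
  have hKH : ∀ i b, Kᴴ i b =
      (d : ℂ)⁻¹ * ∑ k, C (k, k) (i, b) - s / 2 * (if b = i then 1 else 0) := by
    intro i b
    simp only [hK, Matrix.conjTranspose_apply, Matrix.of_apply, star_sub, star_mul', star_inv₀,
      star_natCast, star_sum, hCe, star_div₀, hsr]
    split_ifs <;> simp
  have hCsplit : ∀ i a j b, C (i, a) (j, b) = (Bᴴ * B) (i, a) (j, b) +
      (if a = i then 1 else 0) * Kᴴ j b + K a i * (if b = j then 1 else 0) := by
    intro i a j b
    have e1 : C = (1 - R) * C * (1 - R) + R * C + C * R - R * C * R := by noncomm_ring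
    have eR : ∀ A : Matrix (Fin d × Fin d) (Fin d × Fin d) ℂ, ∀ i a q,
        (R * A) (i, a) q = (if a = i then 1 else 0) * ((d : ℂ)⁻¹ * ∑ k, A (k, k) q) := by
      intro A i a q
      simp [hR, Matrix.mul_apply, Fintype.sum_prod_type, ite_and, Finset.mul_sum, eq_comm]
    have eL : ∀ A : Matrix (Fin d × Fin d) (Fin d × Fin d) ℂ, ∀ p j b,
        (A * R) p (j, b) = ((d : ℂ)⁻¹ * ∑ k, A p (k, k)) * (if b = j then 1 else 0) := by
      intro A p j b
      simp [hR, Matrix.mul_apply, Fintype.sum_prod_type, ite_and, Finset.mul_sum, eq_comm,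
        mul_comm]
    conv_lhs => rw [e1]
    simp only [Matrix.sub_apply, Matrix.add_apply]
    have eS : (d : ℂ)⁻¹ * ∑ k, (R * C) (i, a) (k, k) = (if a = i then 1 else 0) * s := by
      simp only [eR, ← Finset.mul_sum]
      rw [hs, Finset.sum_comm]
      ring
    rw [hB, eL (R * C), eS, eR, eL, hKH]
    simp only [hK, Matrix.of_apply]
    ring
  refine ⟨K, fun r => Matrix.of fun a i => star (B r (i, a)), LinearMap.ext fun X => ?_⟩
  ext a b
  rw [apply_eq_sum_choi, lindbladMap_apply, Matrix.add_apply,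
    ← sum_mul_conjTranspose_mul_self, Matrix.add_apply]
  have e1 : ∑ i, ∑ j, X i j * ((if a = i then 1 else 0) * Kᴴ j b) = (X * Kᴴ) a b := by
    simp [Matrix.mul_apply]
  have e2 : ∑ i, ∑ j, X i j * (K a i * (if b = j then 1 else 0)) = (K * X) a b := by
    simp [Matrix.mul_apply, mul_comm]
  simp only [← hC, hCsplit, mul_add, Finset.sum_add_distrib]
  rw [e1, e2]
  ring

end Choi

/-! ### Block-diagonal operators -/

section Blocks

variable {d NT : ℕ}

/-- The embedding of families of clockwork operators as operators that are block diagonal in the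
register basis. -/
def diagEmb : (Fin (NT + 1) → ClockworkOp d) →ₗ[ℂ] JointOp d NT where
  toFun := Matrix.blockDiagonal
  map_add' := Matrix.blockDiagonal_add
  map_smul' := Matrix.blockDiagonal_smul

theorem diagEmb_apply (σ : Fin (NT + 1) → ClockworkOp d) :
    diagEmb σ = Matrix.blockDiagonal σ := rfl

/-- The block of a joint operator at register state `|l⟩`. -/
def blockAt (l : Fin (NT + 1)) : JointOp d NT →ₗ[ℂ] ClockworkOp d where
  toFun X := Matrix.blockDiag X l
  map_add' _ _ := rfl
  map_smul' _ _ := rfl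

theorem blockAt_apply (l : Fin (NT + 1)) (X : JointOp d NT) (i j : Fin d) :
    blockAt l X i j = X (i, l) (j, l) := rfl

@[simp] theorem blockAt_diagEmb (σ : Fin (NT + 1) → ClockworkOp d) (l : Fin (NT + 1)) :
    blockAt l (diagEmb σ) = σ l := by
  ext i j; simp [blockAt_apply, diagEmb_apply]

theorem withReg_eq_diagEmb (A : ClockworkOp d) (k : Fin (NT + 1)) :
    withReg A k = diagEmb (Pi.single k A) := by
  ext ⟨i, m⟩ ⟨j, n⟩
  rw [diagEmb_apply, Matrix.blockDiagonal_apply]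
  by_cases hm : m = k
  · subst hm
    by_cases hn : m = n
    · subst hn; simp [withReg, regProj]
    · simp [withReg, regProj, hn]
  · by_cases hn : m = n
    · subst hn
      simp [withReg, regProj, hm, Ne.symm hm]
    · simp [withReg, regProj, hn, Ne.symm hm]

theorem diagEmb_eq_sum (σ : Fin (NT + 1) → ClockworkOp d) :
    diagEmb σ = ∑ n, withReg (σ n) n := by
  simp only [withReg_eq_diagEmb, ← map_sum, Finset.univ_sum_single]

/-- `withReg` as a linear map. -/
def withRegLin (k : Fin (NT + 1)) : ClockworkOp d →ₗ[ℂ] JointOp d NT :=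
  diagEmb ∘ₗ LinearMap.single ℂ (fun _ => ClockworkOp d) k

@[simp] theorem withRegLin_apply (A : ClockworkOp d) (k : Fin (NT + 1)) :
    withRegLin k A = withReg A k := (withReg_eq_diagEmb A k).symm

theorem blockAt_withReg (A : ClockworkOp d) (k l : Fin (NT + 1)) :
    blockAt l (withReg A k) = if l = k then A else 0 := by
  rw [withReg_eq_diagEmb, blockAt_diagEmb, Pi.single_apply]

theorem trace_eq_sum_blockAt (X : JointOp d NT) : X.trace = ∑ l, (blockAt l X).trace := by
  simp only [Matrix.trace, Matrix.diag_apply, Fintype.sum_prod_type, blockAt_apply]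
  exact Finset.sum_comm

theorem clockworkGiven_eq (X : JointOp d NT) (l : Fin (NT + 1)) :
    clockworkGiven X l = blockAt l X := by
  ext i j
  simp [clockworkGiven, traceRegister, withReg, regProj, Matrix.mul_apply, blockAt_apply,
    Fintype.sum_prod_type, Matrix.one_apply, Matrix.single_apply, ite_and]

theorem tickProb_eq (M : ℝ → JointMap d NT) (ρ : ClockworkOp d) (k l : Fin (NT + 1)) (t : ℝ) :
    tickProb M ρ k l t = (blockAt l (chanFrom M t k ρ)).trace.re := by
  rw [← clockworkGiven_eq, tickProb, clockworkGiven]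
  congr 1
  simp [Matrix.trace, traceRegister, Fintype.sum_prod_type]

theorem posSemidef_blockAt {X : JointOp d NT} (hX : X.PosSemidef) (l : Fin (NT + 1)) :
    (blockAt l X).PosSemidef := hX.submatrix (fun i => (i, l))

theorem posSemidef_withReg {A : ClockworkOp d} (hA : A.PosSemidef) (k : Fin (NT + 1)) :
    (withReg A k : JointOp d NT).PosSemidef := by
  have h : (regProj k).PosSemidef := by
    have : regProj k = Matrix.vecMulVec (Pi.single k (1 : ℂ)) (star (Pi.single k 1)) := by
      ext a b
      simp [regProj, Matrix.vecMulVec_apply, Matrix.single_apply, Pi.single_apply, ite_and,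
        eq_comm]
      split_ifs <;> rfl
    rw [this]
    exact Matrix.posSemidef_vecMulVec_self_star _
  exact hA.kronecker h

theorem trace_withReg (A : ClockworkOp d) (k : Fin (NT + 1)) :
    (withReg A k : JointOp d NT).trace = A.trace := by
  rw [trace_eq_sum_blockAt]
  simp [blockAt_withReg, apply_ite]

/-- The states span, so membership of `withReg X k` in a subspace can be checked on states. -/
theorem withReg_mem_of_states (S : Submodule ℂ (JointOp d NT)) (k : Fin (NT + 1))
    (h : ∀ ρ, IsState ρ → withReg ρ k ∈ S) (X : ClockworkOp d) : withReg X k ∈ S := by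
  have : (⊤ : Submodule ℂ (ClockworkOp d)) ≤ S.comap (withRegLin k) := by
    rw [← span_isState, Submodule.span_le]
    intro ρ hρ
    simpa using h ρ hρ
  simpa using this (Submodule.mem_top (x := X))

end Blocks

/-! ### The clock generated by `H`, `L`, `J` -/

section Generator

variable {d NT : ℕ} (r : RegisterKind) {m : ℕ} (H : ClockworkOp d) (L J : Fin m → ClockworkOp d)

/-- The drift `-i H - ½ ∑ (L†L + θ(k) J†J)` of the clockwork at register state `k`. -/
noncomputable def drift (k : Fin (NT + 1)) : ClockworkOp d :=
  -(Complex.I • H) - (1 / 2 : ℂ) • ∑ j, ((L j)ᴴ * L j + theta r k • ((J j)ᴴ * J j))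

/-- The generator on families of clockwork operators indexed by the register states. -/
noncomputable def blockGen : Module.End ℂ (Fin (NT + 1) → ClockworkOp d) :=
  LinearMap.pi fun l => lindbladMap (drift r H L J l) L ∘ₗ LinearMap.proj l +
    (theta r (l - 1) • ∑ j, conjMap (J j)) ∘ₗ LinearMap.proj (l - 1)

/-- The Kraus operators of the joint generator: `Lⱼ ⊗ 1` and `θ(k) Jⱼ ⊗ |k+1⟩⟨k|`. -/
noncomputable def jointKraus : Fin m ⊕ (Fin m × Fin (NT + 1)) → JointOp d NT
  | .inl j => Matrix.blockDiagonal fun _ => L j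
  | .inr (j, k) => theta r k • (J j ⊗ₖ Matrix.single (k + 1) k 1)

/-- The generator on joint operators. -/
noncomputable def jointGen : JointMap d NT :=
  lindbladMap (Matrix.blockDiagonal (drift r H L J)) (jointKraus r L J)

@[simp] theorem star_theta (k : Fin (NT + 1)) : star (theta r k) = theta r k := by
  cases r <;> simp [theta, apply_ite]

@[simp] theorem theta_mul_theta (k : Fin (NT + 1)) : theta r k * theta r k = theta r k := by
  cases r <;> simp [theta]

theorem theta_nonneg (k : Fin (NT + 1)) : 0 ≤ theta r k := by
  cases r
  · simp [theta]
  · simp only [theta]; split_ifs <;> simp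

theorem blockGen_apply (σ : Fin (NT + 1) → ClockworkOp d) (l : Fin (NT + 1)) :
    blockGen r H L J σ l =
      lindbladMap (drift r H L J l) L (σ l) + tickGen r J (l - 1) (σ (l - 1)) := by
  simp [blockGen, tickGen]

theorem drift_conjTranspose (hH : H.IsHermitian) (k : Fin (NT + 1)) :
    (drift r H L J k)ᴴ =
      Complex.I • H - (1 / 2 : ℂ) • ∑ j, ((L j)ᴴ * L j + theta r k • ((J j)ᴴ * J j)) := by
  have h2 : star (1 / 2 : ℂ) = 1 / 2 := by simp
  simp only [drift, Matrix.conjTranspose_sub, Matrix.conjTranspose_neg,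
    Matrix.conjTranspose_smul, hH.eq, Complex.star_def, Complex.conj_I, Matrix.conjTranspose_sum,
    Matrix.conjTranspose_add, Matrix.conjTranspose_mul, Matrix.conjTranspose_conjTranspose]
  simp only [← Complex.star_def, star_theta, h2, neg_smul, neg_neg]

theorem noTickGen_eq (hH : H.IsHermitian) (k : Fin (NT + 1)) (X : ClockworkOp d) :
    noTickGen r H L J k X = lindbladMap (drift r H L J k) L X := by
  rw [lindbladMap_apply, drift_conjTranspose r H L J hH, noTickGen, drift]
  simp only [sub_mul, mul_sub, neg_mul, smul_mul_assoc, mul_smul_comm, Finset.sum_mul,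
    Finset.mul_sum, Finset.sum_add_distrib, smul_add, smul_sub, add_mul, mul_add]
  abel

theorem blockGen_single (hH : H.IsHermitian) (k : Fin (NT + 1)) (X : ClockworkOp d) :
    blockGen r H L J (Pi.single k X) =
      Pi.single k (noTickGen r H L J k X) + Pi.single (k + 1) (tickGen r J k X) := by
  funext l
  rw [blockGen_apply, Pi.add_apply, noTickGen_eq r H L J hH]
  congr 1
  · by_cases h : l = k
    · subst h; simp
    · simp [h]
  · by_cases h : l = k + 1
    · subst h; simp
    · have : l - 1 ≠ k := fun h' => h (by rw [← h', sub_add_cancel])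
      simp [h, this, tickGen]

theorem jointGen_diagEmb (σ : Fin (NT + 1) → ClockworkOp d) :
    jointGen r H L J (diagEmb σ) = diagEmb (blockGen r H L J σ) := by
  have hhop : ∀ j (k n : Fin (NT + 1)) (A : ClockworkOp d), jointKraus r L J (.inr (j, k)) * withReg A n *
      (jointKraus r L J (.inr (j, k)))ᴴ =
        if n = k then withReg (theta r k • (J j * A * (J j)ᴴ)) (k + 1) else 0 := by
    intro j k n A
    by_cases h : n = k
    · subst h
      simp only [jointKraus, withReg, regProj, Matrix.conjTranspose_smul, star_theta,
        Matrix.conjTranspose_kronecker, Matrix.smul_mul, Matrix.mul_smul, smul_smul,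
        ← Matrix.mul_kronecker_mul, theta_mul_theta, if_true, Matrix.smul_kronecker]
      simp
    · simp only [jointKraus, withReg, regProj, Matrix.conjTranspose_smul,
        Matrix.conjTranspose_kronecker, Matrix.smul_mul, Matrix.mul_smul,
        ← Matrix.mul_kronecker_mul, if_neg h]
      simp [Ne.symm h]
  have hsum : ∀ j k, jointKraus r L J (.inr (j, k)) * diagEmb σ *
      (jointKraus r L J (.inr (j, k)))ᴴ =
        diagEmb (Pi.single (k + 1) (theta r k • (J j * σ k * (J j)ᴴ))) := by
    intro j k
    rw [diagEmb_eq_sum σ, Finset.mul_sum, Finset.sum_mul, ← withReg_eq_diagEmb]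
    simp only [hhop, Finset.sum_ite_eq', Finset.mem_univ, if_true]
  rw [jointGen, lindbladMap_apply, Fintype.sum_sum_type, Fintype.sum_prod_type]
  simp only [hsum]
  simp only [jointKraus, diagEmb_apply, Matrix.blockDiagonal_conjTranspose,
    ← Matrix.blockDiagonal_mul]
  simp only [← diagEmb_apply, ← map_sum, ← map_add]
  congr 1
  funext l
  rw [blockGen_apply, lindbladMap_apply, tickGen]
  simp only [Pi.add_apply, Finset.sum_apply]
  have hs : ∀ j, ∑ k, (Pi.single (k + 1) (theta r k • (J j * σ k * (J j)ᴴ)) :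
      Fin (NT + 1) → ClockworkOp d) l =
      theta r (l - 1) • (J j * σ (l - 1) * (J j)ᴴ) := by
    intro j
    rw [Finset.sum_eq_single (l - 1)]
    · simp
    · intro k _ hk
      rw [Pi.single_eq_of_ne]
      rintro rfl
      exact hk (by simp)
    · simp
  simp only [hs, Finset.smul_sum]
  abel

theorem jointGen_trace_condition (hH : H.IsHermitian) :
    Matrix.blockDiagonal (drift r H L J) + (Matrix.blockDiagonal (drift r H L J))ᴴ +
      ∑ j, (jointKraus r L J j)ᴴ * jointKraus r L J j = (0 : JointOp d NT) := by
  have hhop : ∀ j (k : Fin (NT + 1)), (jointKraus r L J (.inr (j, k)))ᴴ * jointKraus r L J (.inr (j, k)) =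
      diagEmb (Pi.single k (theta r k • ((J j)ᴴ * J j))) := by
    intro j k
    rw [← withReg_eq_diagEmb]
    simp only [jointKraus, withReg, regProj, Matrix.conjTranspose_smul, star_theta,
      Matrix.conjTranspose_kronecker, Matrix.smul_mul, Matrix.mul_smul, smul_smul,
      ← Matrix.mul_kronecker_mul, theta_mul_theta, Matrix.smul_kronecker]
    simp
  rw [Fintype.sum_sum_type, Fintype.sum_prod_type]
  simp only [hhop]
  simp only [jointKraus, Matrix.blockDiagonal_conjTranspose, ← Matrix.blockDiagonal_mul]
  simp only [← diagEmb_apply, ← map_sum, ← map_add]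
  rw [← map_zero diagEmb]
  congr 1
  funext l
  simp only [Pi.add_apply, Finset.sum_apply, drift_conjTranspose r H L J hH, Pi.zero_apply]
  simp only [drift, Finset.sum_pi_single, Finset.mem_univ, if_true, Finset.sum_add_distrib]
  module

theorem jointGen_withReg (hH : H.IsHermitian) (k : Fin (NT + 1)) (X : ClockworkOp d) :
    jointGen r H L J (withReg X k) =
      withReg (noTickGen r H L J k X) k + withReg (tickGen r J k X) (k + 1) := by
  simp only [withReg_eq_diagEmb]
  rw [jointGen_diagEmb, blockGen_single r H L J hH, map_add]

theorem shortTimeMap_eq (hH : H.IsHermitian) (δ : ℝ) (k : Fin (NT + 1)) (ρ : ClockworkOp d) :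
    shortTimeMap r H L J δ k ρ = withReg ρ k + δ • jointGen r H L J (withReg ρ k) := by
  rw [jointGen_withReg r H L J hH, shortTimeMap, smul_add, add_assoc, Complex.coe_smul,
    Complex.coe_smul]

theorem trace_noTickGen (hH : H.IsHermitian) (k : Fin (NT + 1)) (X : ClockworkOp d) :
    (noTickGen r H L J k X).trace = -(tickGen r J k X).trace := by
  have h := trace_lindbladMap (Matrix.blockDiagonal (drift r H L J)) (jointKraus r L J)
    (withReg X k)
  rw [jointGen_trace_condition r H L J hH, zero_mul, Matrix.trace_zero] at h
  change (jointGen r H L J (withReg X k)).trace = 0 at h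
  rw [jointGen_withReg r H L J hH, Matrix.trace_add, trace_withReg, trace_withReg] at h
  exact eq_neg_of_add_eq_zero_left h

end Generator

/-! ### Sufficiency: the clock generated by `H`, `L`, `J` -/

section Sufficiency

variable {d NT : ℕ} (r : RegisterKind) {m : ℕ} (H : ClockworkOp d) (L J : Fin m → ClockworkOp d)

/-- The family of channels `exp (t G)` for the joint generator `G`. -/
noncomputable def clockFlow (t : ℝ) : JointMap d NT := expFlow (jointGen r H L J) t

theorem clockFlow_isChannelFamily (hH : H.IsHermitian) :
    IsChannelFamily (clockFlow r H L J : ℝ → JointMap d NT) := fun _ ht =>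
  isQuantumChannel_expFlow_lindbladMap _ _ (jointGen_trace_condition r H L J hH) ht

theorem clockFlow_selfTiming : SelfTiming (clockFlow r H L J : ℝ → JointMap d NT) :=
  fun t₁ t₂ _ _ => expFlow_add _ t₁ t₂

theorem clockFlow_zerothOrder : ZerothOrder (clockFlow r H L J : ℝ → JointMap d NT) := by
  refine ⟨expFlow_zero _, fun ε hε => ?_⟩
  have h : ∀ X : JointOp d NT, (fun t => (clockFlow r H L J t - 1) X) =o[𝓝[>] 0]
      (fun _ : ℝ => (1 : ℝ)) := by
    intro X
    rw [isLittleO_one_iff]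
    have := (hasDerivAt_expFlow (jointGen r H L J) X 0).continuousAt.tendsto.sub_const X
    simp only [expFlow_zero, Module.End.one_apply, sub_self] at this
    exact this.mono_left nhdsWithin_le_nhds
  filter_upwards [uniform_of_pointwise_isLittleO _ _ h hε] with t ht X
  simpa using ht X

theorem clockFlow_diagEmb (σ : Fin (NT + 1) → ClockworkOp d) (t : ℝ) :
    clockFlow r H L J t (diagEmb σ) = diagEmb (expFlow (blockGen r H L J) t σ) :=
  (expFlow_intertwine diagEmb (fun σ => (jointGen_diagEmb r H L J σ).symm) t σ).symm

theorem chanFrom_clockFlow (k : Fin (NT + 1)) (ρ : ClockworkOp d) (t : ℝ) :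
    chanFrom (clockFlow r H L J) t k ρ = diagEmb (expFlow (blockGen r H L J) t (Pi.single k ρ)) := by
  rw [chanFrom, withReg_eq_diagEmb, clockFlow_diagEmb]

theorem clockFlow_timeInvariant :
    TimeInvariant (clockFlow .periodic H L J : ℝ → JointMap d NT) := by
  intro t _ ρ _ k k' l
  simp only [clockworkGiven_eq, chanFrom_clockFlow, blockAt_diagEmb]
  -- the generator commutes with relabelling the register cyclically
  set S : (Fin (NT + 1) → ClockworkOp d) →ₗ[ℂ] (Fin (NT + 1) → ClockworkOp d) :=
    LinearMap.funLeft ℂ (ClockworkOp d) (fun i => i + (k - k')) with hS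
  have hcomm : ∀ σ, S (blockGen .periodic H L J σ) = blockGen .periodic H L J (S σ) := by
    intro σ
    funext l
    simp only [hS, LinearMap.funLeft_apply, blockGen_apply]
    have : l + (k - k') - 1 = l - 1 + (k - k') := by abel
    rw [this]; rfl
  have h1 := congrFun (expFlow_intertwine S hcomm t (Pi.single k ρ)) (k' + l)
  have h2 : S (Pi.single k ρ) = Pi.single k' ρ := by
    funext i
    simp only [hS, LinearMap.funLeft_apply, Pi.single_apply]
    have : i + (k - k') = k ↔ i = k' := by
      constructor
      · intro h; rw [← sub_eq_zero] at h ⊢; rw [← h]; abel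
      · rintro rfl; abel
    simp only [this]
  rw [h2] at h1
  rw [← h1, hS, LinearMap.funLeft_apply, show k' + l + (k - k') = k + l by abel]

theorem isState_blocks {M : ℝ → JointMap d NT} (hM : IsChannelFamily M) {t : ℝ} (ht : 0 ≤ t)
    {ρ : ClockworkOp d} (hρ : IsState ρ) (k : Fin (NT + 1)) :
    (∀ l, (blockAt l (chanFrom M t k ρ)).PosSemidef) ∧
      ∑ l, (blockAt l (chanFrom M t k ρ)).trace = 1 := by
  refine ⟨fun l => posSemidef_blockAt (IsCP.posSemidef (hM t ht).1 (posSemidef_withReg hρ.1 k)) l,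
    ?_⟩
  rw [← trace_eq_sum_blockAt, chanFrom, (hM t ht).2, trace_withReg, hρ.2]

theorem clockFlow_hasClassicalRegister (hH : H.IsHermitian) :
    HasClassicalRegister (clockFlow r H L J : ℝ → JointMap d NT) := by
  intro t ht k ρ hρ
  obtain ⟨h1, h2⟩ := isState_blocks (clockFlow_isChannelFamily r H L J hH) ht hρ k
  refine ⟨fun n => blockAt n (chanFrom (clockFlow r H L J) t k ρ), fun n => ⟨h1 n, ?_⟩, ?_⟩
  · have h3 := congrArg Complex.re h2
    rw [Complex.re_sum, Complex.one_re] at h3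
    rw [← h3]
    exact Finset.single_le_sum
      (f := fun l => (blockAt l (chanFrom (clockFlow r H L J) t k ρ)).trace.re)
      (fun l _ => (Complex.nonneg_iff.1 (h1 l).trace_nonneg).1) (Finset.mem_univ n)
  · rw [← diagEmb_eq_sum, chanFrom_clockFlow]
    congr 1
    funext n
    simp

theorem clockFlow_expansion (hH : H.IsHermitian) (k : Fin (NT + 1)) (ρ : ClockworkOp d) :
    (fun δ => chanFrom (clockFlow r H L J) δ k ρ - shortTimeMap r H L J δ k ρ) =o[𝓝[>] 0]
      (fun δ : ℝ => δ) := by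
  refine ((expFlow_sub_isLittleO (jointGen r H L J) (withReg ρ k)).mono
    nhdsWithin_le_nhds).congr_left fun t => ?_
  rw [shortTimeMap_eq r H L J hH, ← sub_sub]; rfl

/-! ### The leading-order condition -/

/-- If `q` grows at most at rate `c f` while `f ≥ 0` decays at most at rate `c f`, then
`q = O(t f)` as `t → 0⁺`. -/
theorem le_mul_exp_mul_of_deriv_le {f f' q q' : ℝ → ℝ} {c : ℝ} (hc : 0 ≤ c)
    (hf : ∀ t, HasDerivAt f (f' t) t) (hq : ∀ t, HasDerivAt q (q' t) t)
    (hf0 : ∀ t, 0 ≤ t → 0 ≤ f t) (h1 : ∀ t, 0 ≤ t → -(c * f t) ≤ f' t)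
    (h2 : ∀ t, 0 ≤ t → q' t ≤ c * f t) (hq0 : q 0 = 0) {T : ℝ} (hT : 0 ≤ T) :
    q T ≤ c * T * Real.exp (c * T) * f T := by
  have hexp : ∀ t, HasDerivAt (fun s => Real.exp (c * s) * f s)
      (Real.exp (c * t) * (c * f t + f' t)) t := by
    intro t
    have he : HasDerivAt (fun s => Real.exp (c * s)) (Real.exp (c * t) * c) t := by
      simpa using ((hasDerivAt_id t).const_mul c).exp
    exact (he.mul (hf t)).congr_deriv (by ring)
  have hmono : MonotoneOn (fun s => Real.exp (c * s) * f s) (Set.Ici 0) := by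
    refine monotoneOn_of_deriv_nonneg (convex_Ici 0)
      (fun t _ => (hexp t).continuousAt.continuousWithinAt)
      (fun t _ => (hexp t).differentiableAt.differentiableWithinAt) fun t ht => ?_
    rw [interior_Ici] at ht
    rw [(hexp t).deriv]
    exact mul_nonneg (Real.exp_pos _).le (by linarith [h1 t (le_of_lt ht)])
  have hfb : ∀ s, 0 ≤ s → s ≤ T → f s ≤ Real.exp (c * T) * f T := fun s hs hsT =>
    (le_mul_of_one_le_left (hf0 s hs) (Real.one_le_exp (by positivity))).trans
      (hmono hs hT hsT)
  set F := Real.exp (c * T) * f T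
  have hh : ∀ t, HasDerivAt (fun s => q s - c * F * s) (q' t - c * F) t := fun t =>
    ((hq t).sub ((hasDerivAt_id t).const_mul (c * F))).congr_deriv (by ring)
  have hanti : AntitoneOn (fun s => q s - c * F * s) (Set.Icc 0 T) := by
    refine antitoneOn_of_deriv_nonpos (convex_Icc 0 T)
      (fun t _ => (hh t).continuousAt.continuousWithinAt)
      (fun t _ => (hh t).differentiableAt.differentiableWithinAt) fun t ht => ?_
    rw [interior_Icc] at ht
    rw [(hh t).deriv]
    have := mul_le_mul_of_nonneg_left (hfb t ht.1.le ht.2.le) hc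
    linarith [h2 t ht.1.le]
  have := hanti (Set.left_mem_Icc.2 hT) (Set.right_mem_Icc.2 hT) hT
  simp only [hq0, mul_zero, sub_zero] at this
  calc q T ≤ c * F * T := by linarith
    _ = _ := by simp only [F]; ring

/-- The tick rate is bounded by a multiple of the probability. -/
theorem exists_tickRate_le : ∃ c, 0 ≤ c ∧ ∀ A : ClockworkOp d, A.PosSemidef →
    (∑ j, J j * A * (J j)ᴴ).trace.re ≤ c * A.trace.re := by
  refine ⟨∑ j, ∑ a, ∑ b, ‖((J j)ᴴ * J j) a b‖, by positivity, fun A hA => ?_⟩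
  have e : (∑ j, J j * A * (J j)ᴴ).trace = ∑ j, ∑ a, ∑ b, ((J j)ᴴ * J j) a b * A b a := by
    rw [Matrix.trace_sum]
    refine Finset.sum_congr rfl fun j _ => ?_
    rw [Matrix.trace_mul_comm, ← Matrix.mul_assoc]
    simp [Matrix.trace, Matrix.mul_apply]
  rw [e]
  refine (Complex.re_le_norm _).trans ?_
  simp only [Finset.sum_mul]
  refine (norm_sum_le _ _).trans (Finset.sum_le_sum fun j _ => ?_)
  refine (norm_sum_le _ _).trans (Finset.sum_le_sum fun a _ => ?_)
  refine (norm_sum_le _ _).trans (Finset.sum_le_sum fun b _ => ?_)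
  rw [norm_mul]
  exact mul_le_mul_of_nonneg_left (norm_apply_le_trace hA b a) (norm_nonneg _)

theorem re_trace_tickGen_nonneg (k : Fin (NT + 1)) {A : ClockworkOp d} (hA : A.PosSemidef) :
    0 ≤ (tickGen r J k A).trace.re := by
  have : (tickGen r J k A).PosSemidef :=
    (Matrix.posSemidef_sum _ fun j _ => hA.mul_mul_conjTranspose_same (J j)).smul
      (theta_nonneg r k)
  exact (Complex.nonneg_iff.1 this.trace_nonneg).1

theorem succ_ne_self (hNT : 0 < NT) (k : Fin (NT + 1)) : k + 1 ≠ k := by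
  have : Nontrivial (Fin (NT + 1)) := Fin.nontrivial_iff_two_le.2 (by omega)
  simp only [ne_eq, add_eq_left, Fin.one_eq_zero_iff]
  omega

theorem sum_filter_ne (hNT : 0 < NT) (k : Fin (NT + 1)) (p : Fin (NT + 1) → ℝ) :
    ∑ l with l ≠ k ∧ l ≠ k + 1, p l = ∑ l, p l - p k - p (k + 1) := by
  have h : (Finset.univ.filter fun l => l ≠ k ∧ l ≠ k + 1) =
      (Finset.univ.erase k).erase (k + 1) := by
    ext l; simp [and_comm]
  rw [h]
  have h1 := Finset.add_sum_erase Finset.univ p (Finset.mem_univ k)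
  have h2 := Finset.add_sum_erase (Finset.univ.erase k) p
    (Finset.mem_erase.2 ⟨succ_ne_self hNT k, Finset.mem_univ _⟩)
  linarith

/-- Two or more ticks within time `t` need a first tick followed by a second one, which has
probability `O(t)` times that of exactly one tick. -/
theorem clockFlow_leadingOrder (hH : H.IsHermitian) (hNT : 0 < NT) :
    LeadingOrder (clockFlow .periodic H L J : ℝ → JointMap d NT) := by
  intro ρ hρ k
  obtain ⟨c, hc, hcJ⟩ := exists_tickRate_le J
  set σ : ℝ → Fin (NT + 1) → ClockworkOp d := fun t =>
    expFlow (blockGen .periodic H L J) t (Pi.single k ρ) with hσ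
  have hp : ∀ l t, tickProb (clockFlow .periodic H L J) ρ k l t = (σ t l).trace.re := by
    intro l t
    rw [tickProb_eq, chanFrom_clockFlow, blockAt_diagEmb]
  have hpsd : ∀ t, 0 ≤ t → ∀ l, (σ t l).PosSemidef := by
    intro t ht l
    have := (isState_blocks (clockFlow_isChannelFamily .periodic H L J hH) ht hρ k).1 l
    rwa [chanFrom_clockFlow, blockAt_diagEmb] at this
  have hp0 : ∀ t, 0 ≤ t → ∀ l, 0 ≤ (σ t l).trace.re := fun t ht l =>
    (Complex.nonneg_iff.1 (hpsd t ht l).trace_nonneg).1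
  have hsum : ∀ t, 0 ≤ t → ∑ l, (σ t l).trace.re = 1 := by
    intro t ht
    have := (isState_blocks (clockFlow_isChannelFamily .periodic H L J hH) ht hρ k).2
    simp only [chanFrom_clockFlow, blockAt_diagEmb] at this
    simpa using congrArg Complex.re this
  -- `rate t l` is the rate of ticks out of the register state `l`
  set rate : ℝ → Fin (NT + 1) → ℝ := fun t l =>
    (tickGen .periodic J l (σ t l)).trace.re with hrate
  have hr0 : ∀ t, 0 ≤ t → ∀ l, 0 ≤ rate t l := fun t ht l =>
    re_trace_tickGen_nonneg .periodic J l (hpsd t ht l)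
  have hrc : ∀ t, 0 ≤ t → ∀ l, rate t l ≤ c * (σ t l).trace.re := fun t ht l => by
    simpa [hrate, tickGen, theta] using hcJ _ (hpsd t ht l)
  have hderiv : ∀ l t, HasDerivAt (fun t => (σ t l).trace.re) (rate t (l - 1) - rate t l) t := by
    intro l t
    set φ : (Fin (NT + 1) → ClockworkOp d) →ₗ[ℂ] ℂ :=
      Matrix.traceLinearMap (Fin d) ℂ ℂ ∘ₗ LinearMap.proj l with hφ
    have h1 := (hasDerivAt_expFlow (blockGen .periodic H L J) (Pi.single k ρ) t)
    have h2 := (Complex.reCLM.comp (φ.toContinuousLinearMap.restrictScalars ℝ)).hasFDerivAt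
      |>.comp_hasDerivAt t h1
    refine h2.congr_deriv ?_
    change (blockGen .periodic H L J (σ t) l).trace.re = _
    rw [blockGen_apply, ← noTickGen_eq _ H L J hH, Matrix.trace_add, trace_noTickGen _ H L J hH]
    simp only [hrate, Complex.add_re, Complex.neg_re]
    ring
  have hbound : ∀ T, 0 ≤ T → 1 - (σ T k).trace.re - (σ T (k + 1)).trace.re ≤
      c * T * Real.exp (c * T) * (σ T (k + 1)).trace.re := by
    intro T hT
    refine le_mul_exp_mul_of_deriv_le (f := fun t => (σ t (k + 1)).trace.re)
      (q := fun t => 1 - (σ t k).trace.re - (σ t (k + 1)).trace.re) hc (hderiv (k + 1))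
      (fun t => ((hasDerivAt_const t 1).sub (hderiv k t)).sub (hderiv (k + 1) t))
      (fun t ht => hp0 t ht _) ?_ ?_ ?_ hT
    · intro t ht
      have := hr0 t ht (k + 1 - 1)
      linarith [hrc t ht (k + 1)]
    · intro t ht
      rw [add_sub_cancel_right]
      have := hr0 t ht (k - 1)
      linarith [hrc t ht (k + 1)]
    · have hk : σ 0 k = ρ := by simp [hσ]
      have hk1 : σ 0 (k + 1) = 0 := by simp [hσ, succ_ne_self hNT k]
      simp [hk, hk1, hρ.2]
  simp only [hp]
  refine IsLittleO.of_bound fun ε hε => ?_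
  have hlim : Tendsto (fun T : ℝ => c * T * Real.exp (c * T)) (𝓝[>] 0) (𝓝 0) := by
    have : Continuous fun T : ℝ => c * T * Real.exp (c * T) := by fun_prop
    have h := this.tendsto 0
    simp only [mul_zero, zero_mul] at h
    exact h.mono_left nhdsWithin_le_nhds
  filter_upwards [hlim.eventually (gt_mem_nhds hε), self_mem_nhdsWithin] with t ht1 ht
  have ht0 : (0 : ℝ) ≤ t := le_of_lt ht
  rw [Real.norm_of_nonneg (Finset.sum_nonneg fun l _ => hp0 t ht0 l),
    Real.norm_of_nonneg (hp0 t ht0 _), sum_filter_ne hNT, hsum t ht0]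
  exact (hbound t ht0).trans (mul_le_mul_of_nonneg_right ht1.le (hp0 t ht0 _))

theorem clockFlow_isPeriodicChannel (hH : H.IsHermitian) (hNT : 0 < NT) :
    IsPeriodicChannel (clockFlow .periodic H L J : ℝ → JointMap d NT) :=
  ⟨clockFlow_isChannelFamily _ H L J hH, clockFlow_timeInvariant H L J,
    clockFlow_selfTiming _ H L J, clockFlow_zerothOrder _ H L J,
    clockFlow_leadingOrder H L J hH hNT⟩

/-! ### Short-time expansions and implicit representations -/

theorem theta_cutoff_of_ne {k : Fin (NT + 1)} (hk : k ≠ Fin.last NT) :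
    theta .cutoff k = theta .periodic k := by simp [theta, hk]

theorem shortTimeMap_cutoff_of_ne {k : Fin (NT + 1)} (hk : k ≠ Fin.last NT) (δ : ℝ)
    (ρ : ClockworkOp d) :
    shortTimeMap .cutoff H L J δ k ρ = shortTimeMap .periodic H L J δ k ρ := by
  simp only [shortTimeMap, noTickGen, tickGen, theta_cutoff_of_ne hk]

/-- Partial trace over the clockwork as a linear map. -/
def traceClockworkLin :
    JointOp d NT →ₗ[ℂ] Matrix (Fin (NT + 1)) (Fin (NT + 1)) ℂ where
  toFun := traceClockwork
  map_add' X Y := by ext; simp [traceClockwork, Finset.sum_add_distrib]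
  map_smul' c X := by ext; simp [traceClockwork, Finset.mul_sum]

theorem traceClockwork_withReg (A : ClockworkOp d) (k : Fin (NT + 1)) :
    traceClockwork (withReg A k) = A.trace • regProj k := by
  ext m n
  simp [traceClockwork, withReg, Matrix.trace, Finset.sum_mul]

/-- A family with the short-time expansion of the cut-off clock is a cut-off of every periodic
family with the expansion of the periodic clock. -/
theorem cutoffOf_of_expansion (hH : H.IsHermitian) {M P : ℝ → JointMap d NT}
    (hM : ∀ k ρ, IsState ρ → (fun δ => chanFrom M δ k ρ - shortTimeMap .cutoff H L J δ k ρ)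
      =o[𝓝[>] 0] (fun δ : ℝ => δ))
    (hP : ∀ k, k ≠ Fin.last NT → ∀ ρ, IsState ρ →
      (fun δ => chanFrom P δ k ρ - shortTimeMap .periodic H L J δ k ρ)
        =o[𝓝[>] 0] (fun δ : ℝ => δ)) :
    CutoffOf M P := by
  refine ⟨fun k hk ρ hρ => ?_, fun ρ hρ => ?_⟩
  · refine ((hM k ρ hρ).sub (hP k hk ρ hρ)).congr_left fun t => ?_
    rw [shortTimeMap_cutoff_of_ne H L J hk]
    abel
  · have h := (traceClockworkLin (d := d) (NT := NT)).toContinuousLinearMap.isBigO_comp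
      (fun δ => chanFrom M δ (Fin.last NT) ρ - shortTimeMap .cutoff H L J δ (Fin.last NT) ρ)
      (𝓝[>] 0)
    refine (h.trans_isLittleO (hM (Fin.last NT) ρ hρ)).congr_left fun t => ?_
    have hθ : theta .cutoff (Fin.last NT) = 0 := by simp [theta]
    have ht : ∀ A, tickGen .cutoff J (Fin.last NT) A = 0 := fun A => by simp [tickGen, hθ]
    change traceClockworkLin (_ - _) = _
    rw [map_sub, shortTimeMap, map_add, map_add, map_smul, map_smul]
    change traceClockwork _ - (traceClockwork _ + _ • traceClockwork _ + _ • traceClockwork _) = _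
    rw [traceClockwork_withReg, traceClockwork_withReg, traceClockwork_withReg,
      trace_noTickGen _ H L J hH, ht, hρ.2]
    simp

/-- A self-timed family with the right short-time expansion at positive times is implicitly
represented.  The expansion forces `M⁰ (ρ ⊗ |k⟩⟨k|) = ρ ⊗ |k⟩⟨k|`, since `M⁰ ∘ Mᵗ = Mᵗ`. -/
theorem hasImplicitRepresentation_of_expansion {M : ℝ → JointMap d NT} (hST : SelfTiming M)
    (h : ∀ k ρ, IsState ρ → (fun δ => chanFrom M δ k ρ - shortTimeMap r H L J δ k ρ)
      =o[𝓝[>] 0] (fun δ : ℝ => δ)) :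
    HasImplicitRepresentation r M H L J := by
  constructor
  · intro t ht k ρ _
    refine tendsto_const_nhds.congr' ?_
    filter_upwards [eventually_gt_atTop 0] with N hN
    have hpos : (0 : ℝ) < N := Nat.cast_pos.2 hN
    have hpow : ∀ n : ℕ, M (t / N) ^ (n + 1) = M ((n + 1) * (t / N)) := by
      intro n
      induction n with
      | zero => simp
      | succ n ih =>
        rw [pow_succ', ih, ← hST _ _ (by positivity) (by positivity)]
        congr 1; push_cast; ring
    obtain ⟨n, rfl⟩ : ∃ n, N = n + 1 := ⟨N - 1, by omega⟩
    rw [add_tsub_cancel_right, chanFrom, chanFrom, ← Module.End.mul_apply, ← pow_succ, hpow]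
    congr 2
    push_cast at hpos ⊢
    field_simp
  · intro k ρ hρ
    have hz : M 0 (withReg ρ k) = withReg ρ k := by
      have h1 : Tendsto (fun δ : ℝ => shortTimeMap r H L J δ k ρ) (𝓝[>] 0)
          (𝓝 (withReg ρ k)) := by
        have hc : Continuous fun δ : ℝ => shortTimeMap r H L J δ k ρ := by
          unfold shortTimeMap; fun_prop
        have := hc.tendsto 0
        simp only [shortTimeMap, Complex.ofReal_zero, zero_smul, add_zero] at this
        exact this.mono_left nhdsWithin_le_nhds
      have h2 : Tendsto (fun δ : ℝ => chanFrom M δ k ρ) (𝓝[>] 0) (𝓝 (withReg ρ k)) := by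
        have h3 := (h k ρ hρ).trans_tendsto (tendsto_id.mono_left nhdsWithin_le_nhds)
        have h4 := h3.add h1
        rw [zero_add] at h4
        exact h4.congr fun δ => sub_add_cancel _ _
      have h3 := ((M 0).continuous_of_finiteDimensional.tendsto _).comp h2
      refine tendsto_nhds_unique_of_eventuallyEq h3 h2 ?_
      filter_upwards [self_mem_nhdsWithin] with t ht
      change M 0 (M t (withReg ρ k)) = M t (withReg ρ k)
      rw [← Module.End.mul_apply, ← hST t 0 (le_of_lt ht) le_rfl, add_zero]
    have hsplit : 𝓝[≥] (0 : ℝ) = pure 0 ⊔ 𝓝[>] 0 := by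
      rw [← Set.Ioi_insert, nhdsWithin_insert]
    rw [hsplit, isLittleO_sup]
    refine ⟨?_, h k ρ hρ⟩
    rw [isLittleO_pure]
    simp [chanFrom, hz, shortTimeMap]

theorem clockFlow_isTickingClock (hH : H.IsHermitian) (hNT : 0 < NT) {ρ₀ : JointOp d NT}
    (hρ₀ : IsState ρ₀) : IsTickingClock r ρ₀ (clockFlow r H L J) := by
  refine ⟨hρ₀, ?_⟩
  cases r with
  | periodic => exact clockFlow_isPeriodicChannel H L J hH hNT
  | cutoff =>
    exact ⟨clockFlow_isChannelFamily _ H L J hH, clockFlow_selfTiming _ H L J,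
      clockFlow .periodic H L J, clockFlow_isPeriodicChannel H L J hH hNT,
      cutoffOf_of_expansion H L J hH (fun k ρ _ => clockFlow_expansion _ H L J hH k ρ)
        fun k _ ρ _ => clockFlow_expansion _ H L J hH k ρ⟩

/-- The implicit representation determines the channels from sharp register states. -/
theorem sameFromRegister_clockFlow (hH : H.IsHermitian) {M : ℝ → JointMap d NT}
    (hM : IsChannelFamily M) (hrep : HasImplicitRepresentation r M H L J) :
    SameFromRegister M (clockFlow r H L J) := by
  intro t ht k ρ hρ
  obtain ⟨C, hC, hCb⟩ := exists_norm_channel_le (Fin d × Fin (NT + 1))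
  -- the operators on which `M δ = 1 + δ G + o(δ)` form a subspace
  let S : Submodule ℂ (JointOp d NT) :=
    { carrier := {X | (fun δ : ℝ => M δ X - X - δ • jointGen r H L J X) =o[𝓝[≥] 0]
        (fun δ : ℝ => δ)}
      add_mem' := fun {X Y} hX hY => by
        refine (IsLittleO.add hX hY).congr_left fun δ => ?_
        simp only [map_add, smul_add]; abel
      zero_mem' := by simp
      smul_mem' := fun c X hX => by
        refine (IsLittleO.const_smul_left hX c).congr_left fun δ => ?_
        simp only [Pi.smul_apply, map_smul, smul_sub, smul_comm c] }
  have hS : ∀ σ, diagEmb σ ∈ S := by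
    intro σ
    rw [diagEmb_eq_sum]
    refine S.sum_mem fun n _ => withReg_mem_of_states S n (fun ρ hρ => ?_) _
    refine (hrep.2 n ρ hρ).congr_left fun δ => ?_
    rw [shortTimeMap_eq r H L J hH, ← sub_sub]; rfl
  have hdiv : Tendsto (fun N : ℕ => t / N) atTop (𝓝[≥] 0) :=
    tendsto_nhdsWithin_iff.2 ⟨tendsto_const_div_atTop_nhds_zero_nat t,
      Eventually.of_forall fun N => Set.mem_Ici.2 (by positivity)⟩
  have h1 := tendsto_pow_expFlow (fun N : ℕ => M (t / N)) (blockGen r H L J) diagEmb ht hC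
    (Eventually.of_forall fun N j _ y => hCb _ ((hM _ (by positivity)).pow j) y)
    (fun σ => by
      have h2 := IsLittleO.comp_tendsto (hS σ) hdiv
      refine (h2.congr_left fun N => ?_).trans_isBigO
        (IsBigO.of_bound |t| (Eventually.of_forall fun N => ?_))
      · simp only [Function.comp_apply, jointGen_diagEmb]
      · simp [div_eq_mul_inv]) (Pi.single k ρ)
  rw [← chanFrom_clockFlow, ← withReg_eq_diagEmb] at h1
  refine tendsto_nhds_unique_of_eventuallyEq (hrep.1 t ht k ρ hρ) h1 ?_
  filter_upwards [eventually_gt_atTop 0] with N hN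
  obtain ⟨n, rfl⟩ : ∃ n, N = n + 1 := ⟨N - 1, by omega⟩
  rw [add_tsub_cancel_right, chanFrom, ← Module.End.mul_apply, ← pow_succ]

end Sufficiency

/-! ### Necessity: the generator of a ticking clock -/

section Necessity

variable {d NT : ℕ}

theorem IsPeriodicChannel.exists_generator {P : ℝ → JointMap d NT} (hP : IsPeriodicChannel P) :
    ∃ G : JointMap d NT, ∀ X, (fun t => P t X - X - t • G X) =o[𝓝[>] 0] (fun t : ℝ => t) := by
  obtain ⟨hch, -, hST, ⟨h0, hz⟩, -⟩ := hP
  obtain ⟨C, hC, hCb⟩ := exists_norm_channel_le (Fin d × Fin (NT + 1))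
  exact exists_generator_of_linear_semigroup P h0
    (fun s t hs ht => (congrArg P (add_comm s t)).trans (hST t s ht hs)) hC
    (fun t ht X => hCb _ (hch t ht) X) hz

/-- The blocks of a completely positive map are completely positive: apply the map to half of
the vector `∑ |i⟩|i⟩` with register `|k⟩`. -/
theorem choi_block_posSemidef {Φ : JointMap d NT} (hΦ : IsCP Φ) (k l : Fin (NT + 1)) :
    (choi (blockAt l ∘ₗ Φ ∘ₗ withRegLin k)).PosSemidef := by
  set v : (Fin d × Fin (NT + 1)) × Fin d → ℂ := fun x =>
    if x.1.1 = x.2 ∧ x.1.2 = k then 1 else 0 with hv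
  have h := (hΦ d _ (Matrix.posSemidef_vecMulVec_self_star v)).submatrix
    (fun p : Fin d × Fin d => ((p.2, l), p.1))
  refine (congrArg Matrix.PosSemidef ?_).mp h
  refine Matrix.ext fun p q => Eq.symm ?_
  simp only [choi, LinearMap.comp_apply, blockAt_apply, withRegLin_apply, Matrix.submatrix_apply,
    ampliation]
  have harg : (withReg (Matrix.single p.1 q.1 1) k : JointOp d NT) =
      fun i j => Matrix.vecMulVec v (star v) (i, p.1) (j, q.1) := ?_
  · rw [harg]
  ext ⟨a, m⟩ ⟨b, n⟩
  simp [withReg, regProj, hv, Matrix.vecMulVec_apply, Matrix.single_apply, ite_and, eq_comm]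
  split_ifs <;> simp_all

theorem linearMap_eq_of_states {W : Type*} [AddCommGroup W] [Module ℂ W]
    {f g : ClockworkOp d →ₗ[ℂ] W} (h : ∀ ρ, IsState ρ → f ρ = g ρ) : f = g :=
  LinearMap.ext_on span_isState fun ρ hρ => h ρ hρ

/-- The blocks of the generator of a periodic clock: time invariance identifies them for all
register states, and the leading-order condition leaves only "no tick" and "one tick". -/
theorem IsPeriodicChannel.generator_blocks (hNT : 0 < NT) {P : ℝ → JointMap d NT} (hP : IsPeriodicChannel P)
    {G : JointMap d NT}
    (hG : ∀ X, (fun t => P t X - X - t • G X) =o[𝓝[>] 0] (fun t : ℝ => t)) :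
    (∀ k l, blockAt (k + l) ∘ₗ G ∘ₗ withRegLin k = blockAt l ∘ₗ G ∘ₗ withRegLin 0) ∧
      ∀ k l, l ≠ k → l ≠ k + 1 → blockAt l ∘ₗ G ∘ₗ withRegLin k = 0 := by
  obtain ⟨hch, hTI, hST, -, hLO⟩ := hP
  have hlim : ∀ l X, Tendsto (fun t : ℝ => t⁻¹ • (blockAt l (P t X) - blockAt l X)) (𝓝[>] 0)
      (𝓝 (blockAt l (G X))) := by
    intro l X
    have h1 := tendsto_inv_smul_of_isLittleO (hG X)
    have h2 := ((blockAt l).continuous_of_finiteDimensional.tendsto _).comp h1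
    refine h2.congr fun t => ?_
    change blockAt l (t⁻¹ • (P t X - X)) = _
    rw [← Complex.coe_smul, map_smul, map_sub, Complex.coe_smul]
  constructor
  · intro k l
    refine linearMap_eq_of_states fun ρ hρ => ?_
    simp only [LinearMap.comp_apply, withRegLin_apply]
    refine tendsto_nhds_unique_of_eventuallyEq (hlim (k + l) (withReg ρ k))
      (hlim l (withReg ρ 0)) ?_
    filter_upwards [self_mem_nhdsWithin] with t ht
    have h1 := hTI t (le_of_lt ht) ρ hρ k 0 l
    rw [clockworkGiven_eq, clockworkGiven_eq, zero_add, chanFrom, chanFrom] at h1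
    rw [h1, blockAt_withReg, blockAt_withReg]
    simp
  · intro k l hk hk1
    refine linearMap_eq_of_states fun ρ hρ => ?_
    have hD : ∀ j, j ≠ k → Tendsto (fun t : ℝ => t⁻¹ • blockAt j (P t (withReg ρ k))) (𝓝[>] 0)
        (𝓝 (blockAt j (G (withReg ρ k)))) := by
      intro j hj
      refine (hlim j (withReg ρ k)).congr fun t => ?_
      rw [blockAt_withReg, if_neg hj, sub_zero]
    have hpsd : ∀ j, j ≠ k → (blockAt j (G (withReg ρ k))).PosSemidef := by
      intro j hj
      refine posSemidef_of_tendsto (hD j hj) ?_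
      filter_upwards [self_mem_nhdsWithin] with t ht
      exact ((isState_blocks hch (le_of_lt ht) hρ k).1 j).smul (inv_nonneg.2 (le_of_lt ht))
    have htr : ∀ j, j ≠ k → Tendsto (fun t : ℝ => t⁻¹ * tickProb P ρ k j t) (𝓝[>] 0)
        (𝓝 (blockAt j (G (withReg ρ k))).trace.re) := by
      intro j hj
      have hc : Continuous fun A : ClockworkOp d => A.trace.re :=
        Complex.continuous_re.comp continuous_id.matrix_trace
      refine ((hc.tendsto _).comp (hD j hj)).congr fun t => ?_
      simp [tickProb_eq, chanFrom]
    have hO := (htr (k + 1) (succ_ne_self hNT k)).isBigO_one ℝ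
    have hsum : Tendsto (fun t : ℝ => t⁻¹ * ∑ j with j ≠ k ∧ j ≠ k + 1, tickProb P ρ k j t)
        (𝓝[>] 0) (𝓝 0) := by
      have h1 := ((isBigO_refl (fun t : ℝ => t⁻¹) (𝓝[>] 0)).mul_isLittleO (hLO ρ hρ k))
      exact (isLittleO_one_iff ℝ).1 (h1.trans_isBigO hO)
    have hsum2 : Tendsto (fun t : ℝ => t⁻¹ * ∑ j with j ≠ k ∧ j ≠ k + 1, tickProb P ρ k j t)
        (𝓝[>] 0) (𝓝 (∑ j with j ≠ k ∧ j ≠ k + 1, (blockAt j (G (withReg ρ k))).trace.re)) := by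
      simp only [Finset.mul_sum]
      exact tendsto_finsetSum _ fun j hj => htr j (Finset.mem_filter.1 hj).2.1
    have hz := tendsto_nhds_unique hsum2 hsum
    have hz' := (Finset.sum_eq_zero_iff_of_nonneg fun j hj =>
      (Complex.nonneg_iff.1 (hpsd j (Finset.mem_filter.1 hj).2.1).trace_nonneg).1).1 hz l
      (Finset.mem_filter.2 ⟨Finset.mem_univ _, hk, hk1⟩)
    have htz : (blockAt l (G (withReg ρ k))).trace = 0 :=
      Complex.ext hz' (Complex.nonneg_iff.1 (hpsd l hk).trace_nonneg).2.symm
    simpa using (hpsd l hk).trace_eq_zero_iff.1 htz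

/-- The generator of a periodic clock agrees, on the diagonal blocks, with the joint generator of
some `H`, `L`, `J`. -/
theorem IsPeriodicChannel.exists_lindblad (hd : 0 < d) (hNT : 0 < NT) {P : ℝ → JointMap d NT}
    (hP : IsPeriodicChannel P) {G : JointMap d NT}
    (hG : ∀ X, (fun t => P t X - X - t • G X) =o[𝓝[>] 0] (fun t : ℝ => t)) :
    ∃ (m : ℕ) (H : ClockworkOp d) (L J : Fin m → ClockworkOp d), H.IsHermitian ∧
      ∀ k l X, blockAt l (G (withReg X k)) =
        blockAt l (jointGen .periodic H L J (withReg X k)) := by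
  obtain ⟨hshift, hzero⟩ := hP.generator_blocks hNT hG
  have hne : (1 : Fin (NT + 1)) ≠ 0 := by simpa using succ_ne_self hNT 0
  have hblock : ∀ l X, (fun t => blockAt l (P t X) - blockAt l X - t • blockAt l (G X))
      =o[𝓝[>] 0] (fun t : ℝ => t) := by
    intro l X
    have h := (LinearMap.toContinuousLinearMap (blockAt (d := d) l)).isBigO_comp
      (fun t => P t X - X - t • G X) (𝓝[>] 0)
    refine (h.trans_isLittleO (hG X)).congr_left fun t => ?_
    change blockAt l (P t X - X - t • G X) = _
    rw [← Complex.coe_smul, map_sub, map_sub, map_smul, Complex.coe_smul]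
  obtain ⟨K, V, hE0⟩ := exists_lindblad_form hd (E := blockAt 0 ∘ₗ G ∘ₗ withRegLin 0)
    (Φ := fun t => blockAt 0 ∘ₗ P t ∘ₗ withRegLin 0)
    (fun t ht => choi_block_posSemidef (hP.1 t ht).1 0 0) (fun X => by
      simpa [blockAt_withReg] using hblock 0 (withReg X 0))
  obtain ⟨W, hE1⟩ := exists_kraus (blockAt 1 ∘ₗ G ∘ₗ withRegLin 0)
    (choi_posSemidef_of_isLittleO (Φ := fun t => blockAt 1 ∘ₗ P t ∘ₗ withRegLin 0)
      (fun t ht => choi_block_posSemidef (hP.1 t ht).1 0 1) fun X => by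
        simpa [blockAt_withReg, hne] using hblock 1 (withReg X 0))
  -- trace preservation
  have htrG : ∀ X, (G X).trace = 0 := by
    intro X
    have h1 := tendsto_inv_smul_of_isLittleO (hG X)
    have h2 := ((continuous_id.matrix_trace (n := Fin d × Fin (NT + 1)) (R := ℂ)).tendsto _).comp h1
    refine tendsto_nhds_unique_of_eventuallyEq h2 tendsto_const_nhds ?_
    filter_upwards [self_mem_nhdsWithin] with t ht
    simp [Matrix.trace_smul, Matrix.trace_sub, (hP.1 t (le_of_lt ht)).2]
  have hA : K + Kᴴ + ∑ j, (V j)ᴴ * V j + ∑ j, (W j)ᴴ * W j = 0 := by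
    refine Matrix.ext_iff_trace_mul_right.2 fun X => ?_
    have h1 := htrG (withReg X 0)
    rw [trace_eq_sum_blockAt, Finset.sum_eq_add 0 1 hne.symm (fun l _ hl => by
      have := LinearMap.congr_fun (hzero 0 l hl.1 (by simpa using hl.2)) X
      simp only [LinearMap.comp_apply, withRegLin_apply, LinearMap.zero_apply] at this
      rw [this, Matrix.trace_zero]) (by simp) (by simp)] at h1
    have h2 := LinearMap.congr_fun hE0 X
    have h3 := hE1 X
    simp only [LinearMap.comp_apply, withRegLin_apply] at h2 h3
    rw [h2, h3, trace_lindbladMap, Matrix.trace_sum] at h1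
    rw [add_mul, Matrix.trace_add, Finset.sum_mul, Matrix.trace_sum, zero_mul, Matrix.trace_zero]
    refine Eq.trans (congrArg₂ (· + ·) rfl (Finset.sum_congr rfl fun j _ => ?_)) h1
    rw [Matrix.mul_assoc, Matrix.trace_mul_comm]
  -- both Choi matrices have size `d²`, so `L` and `J` can share the index type `Fin (d * d)`
  set e : Fin (d * d) ≃ Fin d × Fin d := finProdFinEquiv.symm
  set H : ClockworkOp d := (Complex.I / 2) • (K - Kᴴ) with hHdef
  have hH : H.IsHermitian := by
    rw [Matrix.IsHermitian, hHdef, Matrix.conjTranspose_smul, Matrix.conjTranspose_sub,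
      Matrix.conjTranspose_conjTranspose]
    have : star (Complex.I / 2) = -(Complex.I / 2) := by simp [neg_div]
    rw [this]
    module
  have hdrift : ∀ k : Fin (NT + 1), drift .periodic H (V ∘ e) (W ∘ e) k = K := by
    intro k
    have h1 : ∑ j, (((V ∘ e) j)ᴴ * (V ∘ e) j + theta .periodic k • (((W ∘ e) j)ᴴ * (W ∘ e) j)) =
        -(K + Kᴴ) := by
      simp only [theta, one_smul, Finset.sum_add_distrib, Function.comp_apply]
      rw [Equiv.sum_comp e fun j => (V j)ᴴ * V j, Equiv.sum_comp e fun j => (W j)ᴴ * W j]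
      refine eq_neg_of_add_eq_zero_right ?_
      rw [← hA]; abel
    have hI : Complex.I * (Complex.I / 2) = -(1 / 2) := by
      rw [← mul_div_assoc, Complex.I_mul_I]; ring
    rw [drift, h1, hHdef, smul_smul, hI]
    module
  refine ⟨d * d, H, V ∘ e, W ∘ e, hH, fun k l X => ?_⟩
  rw [withReg_eq_diagEmb X k, jointGen_diagEmb, blockAt_diagEmb, blockGen_single _ H _ _ hH,
    ← withReg_eq_diagEmb, Pi.add_apply]
  by_cases hk : l = k
  · subst hk
    have h1 := LinearMap.congr_fun (hshift l 0) X
    rw [hE0, add_zero] at h1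
    simp only [LinearMap.comp_apply, withRegLin_apply] at h1
    rw [h1, Pi.single_eq_same, Pi.single_eq_of_ne (succ_ne_self hNT l).symm, add_zero,
      noTickGen_eq _ H _ _ hH, hdrift, lindbladMap_apply, lindbladMap_apply]
    congr 1
    exact (Equiv.sum_comp e fun j => V j * X * (V j)ᴴ).symm
  · rw [Pi.single_eq_of_ne hk, zero_add]
    by_cases hk1 : l = k + 1
    · subst hk1
      have h1 := LinearMap.congr_fun (hshift k 1) X
      rw [LinearMap.comp_apply, LinearMap.comp_apply, withRegLin_apply, hE1] at h1
      rw [h1, Pi.single_eq_same, tickGen]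
      simp only [theta, one_smul]
      exact (Equiv.sum_comp e fun j => W j * X * (W j)ᴴ).symm
    · rw [Pi.single_eq_of_ne hk1]
      simpa using LinearMap.congr_fun (hzero k l hk hk1) X

theorem HasClassicalRegister.eq_sum {M : ℝ → JointMap d NT} (hM : HasClassicalRegister M) {t : ℝ}
    (ht : 0 ≤ t) (k : Fin (NT + 1)) {ρ : ClockworkOp d} (hρ : IsState ρ) :
    chanFrom M t k ρ = ∑ n, withReg (blockAt n (chanFrom M t k ρ)) n := by
  obtain ⟨σ, -, h⟩ := hM t ht k ρ hρ
  rw [← diagEmb_eq_sum] at h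
  simp only [h, blockAt_diagEmb]
  exact diagEmb_eq_sum σ

/-- If a family with a classical register agrees to first order with a periodic clock when
started in register state `|k⟩`, then the periodic clock has the short-time expansion there. -/
theorem expansion_of_classical {P M : ℝ → JointMap d NT} {G : JointMap d NT}
    (hG : ∀ X, (fun t => P t X - X - t • G X) =o[𝓝[>] 0] (fun t : ℝ => t))
    {m : ℕ} {H : ClockworkOp d} {L J : Fin m → ClockworkOp d} (hH : H.IsHermitian)
    (hblk : ∀ k l X, blockAt l (G (withReg X k)) =
        blockAt l (jointGen .periodic H L J (withReg X k)))
    (hM : HasClassicalRegister M) (k : Fin (NT + 1)) {ρ : ClockworkOp d} (hρ : IsState ρ)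
    (hMP : (fun t => chanFrom M t k ρ - chanFrom P t k ρ) =o[𝓝[>] 0] (fun t : ℝ => t)) :
    (fun t => chanFrom P t k ρ - shortTimeMap .periodic H L J t k ρ) =o[𝓝[>] 0]
      (fun t : ℝ => t) := by
  have h1 : (fun t => chanFrom M t k ρ - withReg ρ k - t • G (withReg ρ k)) =o[𝓝[>] 0]
      (fun t : ℝ => t) := by
    refine (hMP.add (hG (withReg ρ k))).congr_left fun t => ?_
    rw [chanFrom, chanFrom]; abel
  have hmem : G (withReg ρ k) ∈ LinearMap.range (diagEmb (d := d) (NT := NT)) := by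
    refine (Submodule.closed_of_finiteDimensional _).mem_of_tendsto
      (tendsto_inv_smul_of_isLittleO h1) ?_
    filter_upwards [self_mem_nhdsWithin] with t ht
    refine Submodule.smul_mem (LinearMap.range diagEmb |>.restrictScalars ℝ) _
      (Submodule.sub_mem _ ?_ ⟨_, (withReg_eq_diagEmb ρ k).symm⟩)
    rw [hM.eq_sum (le_of_lt ht) k hρ, ← diagEmb_eq_sum]
    exact ⟨_, rfl⟩
  obtain ⟨σ, hσ⟩ := hmem
  have hGJ : G (withReg ρ k) = jointGen .periodic H L J (withReg ρ k) := by
    have h2 : ∀ l, blockAt l (G (withReg ρ k)) = _ := fun l => hblk k l ρ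
    rw [← hσ, withReg_eq_diagEmb, jointGen_diagEmb] at h2 ⊢
    congr 1
    funext l
    simpa using h2 l
  refine (hG (withReg ρ k)).congr_left fun t => ?_
  rw [shortTimeMap_eq _ H L J hH, ← hGJ, ← sub_sub]; rfl

/-- Started in the final register state of a cut-off clock, the register stays there to first
order, so the joint state is determined to first order by the clockwork state. -/
theorem CutoffOf.final_sub_isLittleO {M P : ℝ → JointMap d NT} (hch : IsChannelFamily M)
    (hM : HasClassicalRegister M) (hMP : CutoffOf M P) {ρ : ClockworkOp d} (hρ : IsState ρ) :
    (fun t => chanFrom M t (Fin.last NT) ρ -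
      withReg (traceRegister (chanFrom M t (Fin.last NT) ρ)) (Fin.last NT)) =o[𝓝[>] 0]
        (fun t : ℝ => t) := by
  set X := fun t => chanFrom M t (Fin.last NT) ρ with hX
  have hb : ∀ n, n ≠ Fin.last NT → (fun t => blockAt n (X t)) =o[𝓝[>] 0] (fun t : ℝ => t) := by
    intro n hn
    refine (IsBigO.of_bound 1 ?_).trans_isLittleO (hMP.2 ρ hρ)
    filter_upwards [self_mem_nhdsWithin] with t ht
    have hpsd := (isState_blocks hch (le_of_lt ht) hρ (Fin.last NT)).1 n
    rw [one_mul]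
    calc ‖blockAt n (X t)‖ ≤ (blockAt n (X t)).trace.re :=
          (Matrix.norm_le_iff (Complex.nonneg_iff.1 hpsd.trace_nonneg).1).2
            fun i j => norm_apply_le_trace hpsd i j
      _ ≤ ‖(traceClockwork (X t) - regProj (Fin.last NT)) n n‖ := by
          refine (Complex.re_le_norm _).trans_eq ?_
          congr 1
          simp [traceClockwork, regProj, Ne.symm hn, Matrix.trace,
            blockAt_apply]
      _ ≤ _ := Matrix.norm_entry_le_entrywise_sup_norm _
  have hs : (fun t => ∑ n, (withReg (blockAt n (X t)) n - withReg (blockAt n (X t)) (Fin.last NT)))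
      =o[𝓝[>] 0] (fun t : ℝ => t) := by
    refine IsLittleO.fun_sum fun n _ => ?_
    by_cases hn : n = Fin.last NT
    · subst hn
      simp
    · have h := (LinearMap.toContinuousLinearMap
        (withRegLin (d := d) n - withRegLin (Fin.last NT))).isBigO_comp
          (fun t => blockAt n (X t)) (𝓝[>] 0)
      refine (h.trans_isLittleO (hb n hn)).congr_left fun t => ?_
      simp
  refine hs.congr' ?_ EventuallyEq.rfl
  filter_upwards [self_mem_nhdsWithin] with t ht
  have htr : traceRegister (X t) = ∑ n, blockAt n (X t) := by
    ext i j
    simp [traceRegister, Matrix.sum_apply, blockAt_apply]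
  have hXt : X t = ∑ n, withReg (blockAt n (X t)) n := hM.eq_sum (le_of_lt ht) _ hρ
  change _ = X t - withReg (traceRegister (X t)) (Fin.last NT)
  rw [Finset.sum_sub_distrib, ← hXt, htr, ← withRegLin_apply, map_sum]
  simp

/-- A cut-off clock with classical register is implicitly represented itself, unless its
clockwork evolves differently from the represented clock once the final register state is
reached. -/
theorem exists_implicit_cutoff (hd : 0 < d) (hNT : 0 < NT) {ρ₀ : JointOp d NT}
    (hρ₀ : IsState ρ₀) {M : ℝ → JointMap d NT} (hM : IsTickingClock .cutoff ρ₀ M)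
    (hcl : HasClassicalRegister M) :
    ∃ M' : ℝ → JointMap d NT,
      (M' = M ∨ ClockworkEquivalent ρ₀ ρ₀ M M') ∧
      IsTickingClock .cutoff ρ₀ M' ∧ HasClassicalRegister M' ∧
      ∃ (m : ℕ) (H : ClockworkOp d) (L J : Fin m → ClockworkOp d),
        H.IsHermitian ∧ HasImplicitRepresentation .cutoff M' H L J := by
  have hM0 := hM
  obtain ⟨-, hch, hST, P, hP, hMP⟩ := hM
  obtain ⟨G, hG⟩ := hP.exists_generator
  obtain ⟨m, H, L, J, hH, hblk⟩ := hP.exists_lindblad hd hNT hG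
  have hPexp : ∀ k, k ≠ Fin.last NT → ∀ ρ, IsState ρ →
      (fun t => chanFrom P t k ρ - shortTimeMap .periodic H L J t k ρ) =o[𝓝[>] 0]
        (fun t : ℝ => t) := fun k hk ρ hρ =>
    expansion_of_classical hG hH hblk hcl k hρ (hMP.1 k hk ρ hρ)
  set M' : ℝ → JointMap d NT := clockFlow .cutoff H L J
  have hM'exp : ∀ k ρ, IsState ρ →
      (fun δ => chanFrom M' δ k ρ - shortTimeMap .cutoff H L J δ k ρ) =o[𝓝[>] 0]
        (fun δ : ℝ => δ) := fun k ρ _ => clockFlow_expansion _ H L J hH k ρ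
  have hM'P : CutoffOf M' P := cutoffOf_of_expansion H L J hH hM'exp hPexp
  have hM'clock : IsTickingClock .cutoff ρ₀ M' := clockFlow_isTickingClock _ H L J hH hNT hρ₀
  have hM'cl : HasClassicalRegister M' := clockFlow_hasClassicalRegister _ H L J hH
  by_cases hdiff : ∃ t, 0 ≤ t ∧ ∃ ρ : ClockworkOp d, IsState ρ ∧
      traceRegister (chanFrom M t (Fin.last NT) ρ) ≠
        traceRegister (chanFrom M' t (Fin.last NT) ρ)
  · exact ⟨M', Or.inr ⟨hM0, hM'clock, ⟨P, hP, hMP, hM'P⟩, hdiff⟩, hM'clock, hM'cl, m, H, L, J, hH,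
      hasImplicitRepresentation_of_expansion _ H L J (clockFlow_selfTiming _ H L J) hM'exp⟩
  · push Not at hdiff
    refine ⟨M, Or.inl rfl, hM0, hcl, m, H, L, J, hH,
      hasImplicitRepresentation_of_expansion _ H L J hST fun k ρ hρ => ?_⟩
    by_cases hk : k = Fin.last NT
    · subst hk
      have h1 := (hMP.final_sub_isLittleO hch hcl hρ).sub
        (hM'P.final_sub_isLittleO (clockFlow_isChannelFamily _ H L J hH) hM'cl hρ)
      refine (h1.add (hM'exp (Fin.last NT) ρ hρ)).congr' ?_ EventuallyEq.rfl
      filter_upwards [self_mem_nhdsWithin] with t ht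
      rw [hdiff t (le_of_lt ht) ρ hρ]
      abel
    · refine ((hMP.1 k hk ρ hρ).add (hPexp k hk ρ hρ)).congr_left fun t => ?_
      rw [shortTimeMap_cutoff_of_ne H L J hk]
      abel

theorem hasImplicitRepresentation_periodic (hd : 0 < d) (hNT : 0 < NT) {M : ℝ → JointMap d NT}
    (hM : IsPeriodicChannel M) (hcl : HasClassicalRegister M) :
    ∃ (m : ℕ) (H : ClockworkOp d) (L J : Fin m → ClockworkOp d),
      H.IsHermitian ∧ HasImplicitRepresentation .periodic M H L J := by
  obtain ⟨G, hG⟩ := hM.exists_generator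
  obtain ⟨m, H, L, J, hH, hblk⟩ := hM.exists_lindblad hd hNT hG
  refine ⟨m, H, L, J, hH, hasImplicitRepresentation_of_expansion _ H L J hM.2.2.1
    fun k ρ hρ => expansion_of_classical hG hH hblk hcl k hρ ?_⟩
  simp

end Necessity

end TickingClock

open TickingClock
theorem mainTheorem2 (d NT : ℕ) (hd : 0 < d) (hNT : 0 < NT) (r : RegisterKind)
    (ρ₀ : JointOp d NT) (hρ₀ : IsState ρ₀) :
    -- necessity
    (∀ M : ℝ → JointMap d NT, IsTickingClock r ρ₀ M → HasClassicalRegister M →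
      ∃ M' : ℝ → JointMap d NT,
        (M' = M ∨ (r = RegisterKind.cutoff ∧ ClockworkEquivalent ρ₀ ρ₀ M M')) ∧
        IsTickingClock r ρ₀ M' ∧ HasClassicalRegister M' ∧
        ∃ (m : ℕ) (H : ClockworkOp d) (L J : Fin m → ClockworkOp d),
          H.IsHermitian ∧ HasImplicitRepresentation r M' H L J) ∧
    -- sufficiency
    (∀ (m : ℕ) (H : ClockworkOp d) (L J : Fin m → ClockworkOp d), H.IsHermitian →
      ∃ M' : ℝ → JointMap d NT,
        IsTickingClock r ρ₀ M' ∧ HasClassicalRegister M' ∧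
        HasImplicitRepresentation r M' H L J ∧
        ∀ M : ℝ → JointMap d NT, IsChannelFamily M →
          HasImplicitRepresentation r M H L J → SameFromRegister M M') := by
  refine ⟨fun M hM hcl => ?_, fun m H L J hH => ?_⟩
  · cases r with
    | periodic => exact ⟨M, Or.inl rfl, hM, hcl, hasImplicitRepresentation_periodic hd hNT hM.2 hcl⟩
    | cutoff =>
      obtain ⟨M', h, hrest⟩ := exists_implicit_cutoff hd hNT hρ₀ hM hcl
      exact ⟨M', h.imp id fun h => ⟨rfl, h⟩, hrest⟩
  · exact ⟨clockFlow r H L J, clockFlow_isTickingClock r H L J hH hNT hρ₀,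
      clockFlow_hasClassicalRegister r H L J hH,
      hasImplicitRepresentation_of_expansion r H L J (clockFlow_selfTiming r H L J)
        fun k ρ _ => clockFlow_expansion r H L J hH k ρ,
      fun M hM hrep => sameFromRegister_clockFlow r H L J hH hM hrep⟩
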